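/- Let $n\ge 1$ and let $\mathbb H^n=\{x\in\mathbb R^n: x_n>0\}$ be hyperbolic space in the half-space model, with the metric $ds^2=(dx_1^2+\cdots+dx_n^2)/x_n^2$, volume $dV=x_n^{-n}\,dx$ and Laplacian $\Delta=x_n^2\sum_{j=1}^n\partial_j^2+(2-n)x_n\partial_n$. Let $\Omega\subset\mathbb H^n$ be a bounded domain (a nonempty connected open set of finite hyperbolic diameter), and let $\lambda_1\le\lambda_2\le\cdots$ be the eigenvalues, listed with multiplicity, of the clamped plate problem $$\Delta^2u=\lambda u\ \text{ in }\Omega,\qquad u=\frac{\partial u}{\partial\nu}=0\ \text{ on }\partial\Omega,$$ understood weakly: $u\in H^2_0(\Omega)$ (the closure of $C_c^\infty(\Omega)$ in $H^2(\Omega)$) and $\Delta^2u=\lambda u$ in the sense of distributions. For $\lambda>0$, let $\Im_\lambda$ be the set of pairs $(f,g)$ of positive functions on $]0,\lambda[$ such that, for all $x\ne y$ in $]0,\lambda[$, $$\Big(\frac{f(x)-f(y)}{x-y}\Big)^2+\Big(\frac{f(x)^2}{g(x)(\lambda-x)}+\frac{f(y)^2}{g(y)(\lambda-y)}\Big)\frac{g(x)-g(y)}{x-y}\le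 0.$$ Then, for every $k\ge1$ with $\lambda_{k+1}>\lambda_k$ and every $(f,g)\in\Im_{\lambda_{k+1}}$, $$\sum_{i=1}^kf(\lambda_i)\le\Big[\sum_{i=1}^kg(\lambda_i)\big(6\lambda_i^{1/2}-(n-1)^2\big)\Big]^{1/2}\Big[\sum_{i=1}^k\frac{f(\lambda_i)^2}{g(\lambda_i)(\lambda_{k+1}-\lambda_i)}\big(4\lambda_i^{1/2}-(n-1)^2\big)\Big]^{1/2}.$$ -/

import Mathlib

open MeasureTheory Filter Topology
open scoped ContDiff ENNReal

namespace HypClamped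

noncomputable section

/-! ### The half-space model of hyperbolic space -/

/-- The coordinate space `ℝⁿ` with its Euclidean norm. -/
abbrev Coord (n : ℕ) : Type := EuclideanSpace ℝ (Fin n)

/-- The index of the last coordinate (that of `x_n`); here `n ≥ 1`. -/
def lastIdx (n : ℕ) [NeZero n] : Fin n := ⟨n - 1, Nat.sub_one_lt (NeZero.ne n)⟩

/-- The last coordinate `x_n`. -/
def height {n : ℕ} [NeZero n] (x : Coord n) : ℝ := x (lastIdx n)

/-- The underlying set `{x ∈ ℝⁿ : x_n > 0}` of the half-space model of `ℍⁿ`. -/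
def halfSpace (n : ℕ) [NeZero n] : Set (Coord n) := {x | 0 < height x}

/-- The hyperbolic metric `ds² = (dx₁² + ⋯ + dx_n²) / x_n²` at the point `x`. -/
def hypMetric {n : ℕ} [NeZero n] (x v w : Coord n) : ℝ := inner ℝ v w / height x ^ 2

/-- Hyperbolic length of the curve `γ` restricted to `[0, 1]`. -/
def hypLength {n : ℕ} [NeZero n] (γ : ℝ → Coord n) : ℝ≥0∞ :=
  ∫⁻ t in Set.Icc (0 : ℝ) 1, ENNReal.ofReal √(hypMetric (γ t) (deriv γ t) (deriv γ t))

/-- Hyperbolic distance: the infimum of the lengths of `C¹` curves in the half-space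
that join the two points. -/
def hypEDist {n : ℕ} [NeZero n] (x y : Coord n) : ℝ≥0∞ :=
  ⨅ γ ∈ {γ : ℝ → Coord n | ContDiff ℝ 1 γ ∧ Set.MapsTo γ (Set.Icc 0 1) (halfSpace n) ∧
    γ 0 = x ∧ γ 1 = y}, hypLength γ

/-- A bounded domain of `ℍⁿ`: a nonempty connected open subset of the half-space, of finite
diameter for the hyperbolic distance. -/
structure BoundedDomain (n : ℕ) [NeZero n] where
  carrier : Set (Coord n)
  isOpen : IsOpen carrier
  isConnected : IsConnected carrier
  subset_halfSpace : carrier ⊆ halfSpace n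
  bounded : ∃ R : ℝ, ∀ x ∈ carrier, ∀ y ∈ carrier, hypEDist x y ≤ ENNReal.ofReal R

/-- The Riemannian volume of `Ω`: `dV = x_n⁻ⁿ dx` restricted to `Ω`. -/
def vol {n : ℕ} [NeZero n] (Ω : BoundedDomain n) : Measure (Coord n) :=
  ((volume : Measure (Coord n)).withDensity
    (fun x => ENNReal.ofReal ((height x ^ n)⁻¹))).restrict Ω.carrier

/-- The coordinate derivative `∂φ/∂x_a`. -/
def pd {n : ℕ} (a : Fin n) (φ : Coord n → ℝ) (x : Coord n) : ℝ :=
  fderiv ℝ φ x (EuclideanSpace.single a 1)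

/-- The Laplacian of `ℍⁿ` in the coordinates of the half-space model:
`Δ = x_n² ∑_j ∂²/∂x_j² + (2 - n) x_n ∂/∂x_n`. -/
def hypLap {n : ℕ} [NeZero n] (φ : Coord n → ℝ) (x : Coord n) : ℝ :=
  height x ^ 2 * ∑ j, pd j (pd j φ) x + (2 - (n : ℝ)) * height x * pd (lastIdx n) φ x

/-! ### Test functions and the Sobolev space `H²₀(Ω)` -/

/-- `φ ∈ C_c^∞(Ω)`. -/
structure IsTest {n : ℕ} [NeZero n] (Ω : BoundedDomain n) (φ : Coord n → ℝ) : Prop where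
  smooth : ContDiff ℝ ∞ φ
  compact : HasCompactSupport φ
  supp : tsupport φ ⊆ Ω.carrier

/-- `F j → v` in `L²(μ)`. -/
def L2Lim {α : Type*} [MeasurableSpace α] (μ : Measure α) (F : ℕ → α → ℝ) (v : α → ℝ) : Prop :=
  Tendsto (fun j => eLpNorm (F j - v) 2 μ) atTop (𝓝 0)

/-- `u ∈ H²₀(Ω)`, the closure of `C_c^∞(Ω)` in the `H²` norm: there are test functions `φ j`
that converge to `u` in `L²(Ω)` and whose coordinate derivatives of order one and two converge
in `L²(Ω)` (the limits are then the weak derivatives of `u`). Since the closure of a bounded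
domain is compact in the half-space, the coordinate derivatives and the covariant derivatives
define equivalent norms. -/
def MemH20 {n : ℕ} [NeZero n] (Ω : BoundedDomain n) (u : Lp ℝ 2 (vol Ω)) : Prop :=
  ∃ (φ : ℕ → Coord n → ℝ) (d₁ : Fin n → Lp ℝ 2 (vol Ω)) (d₂ : Fin n → Fin n → Lp ℝ 2 (vol Ω)),
    (∀ j, IsTest Ω (φ j)) ∧
    L2Lim (vol Ω) φ u ∧
    (∀ a, L2Lim (vol Ω) (fun j => pd a (φ j)) (d₁ a)) ∧
    (∀ a b, L2Lim (vol Ω) (fun j => pd a (pd b (φ j))) (d₂ a b))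

/-- `Δ²u = μ u` in `Ω`, in the sense of distributions. -/
def SolvesBiharm {n : ℕ} [NeZero n] (Ω : BoundedDomain n) (μ : ℝ) (u : Lp ℝ 2 (vol Ω)) : Prop :=
  ∀ φ : Coord n → ℝ, IsTest Ω φ →
    ∫ x, u x * hypLap (hypLap φ) x ∂(vol Ω) = μ * ∫ x, u x * φ x ∂(vol Ω)

/-! ### Facts needed to see that the eigenspaces are vector spaces -/

section Helpers

variable {n : ℕ} [NeZero n] {Ω : BoundedDomain n}

theorem contDiff_height : ContDiff ℝ ∞ (height : Coord n → ℝ) := by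
  unfold height
  fun_prop

theorem pd_add {n : ℕ} (a : Fin n) {φ ψ : Coord n → ℝ} (hφ : ContDiff ℝ ∞ φ) (hψ : ContDiff ℝ ∞ ψ) :
    pd a (φ + ψ) = pd a φ + pd a ψ := by
  funext x
  have h1 : DifferentiableAt ℝ φ x := (hφ.differentiable (by simp)) x
  have h2 : DifferentiableAt ℝ ψ x := (hψ.differentiable (by simp)) x
  simp [pd, fderiv_add h1 h2]

theorem pd_smul {n : ℕ} (a : Fin n) (c : ℝ) {φ : Coord n → ℝ} (hφ : ContDiff ℝ ∞ φ) :
    pd a (c • φ) = c • pd a φ := by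
  funext x
  have h1 : DifferentiableAt ℝ φ x := (hφ.differentiable (by simp)) x
  simp [pd, fderiv_const_smul h1 c]

theorem IsTest.zero : IsTest Ω (0 : Coord n → ℝ) where
  smooth := contDiff_const
  compact := HasCompactSupport.zero
  supp := by simp [tsupport]

theorem IsTest.add {φ ψ : Coord n → ℝ} (hφ : IsTest Ω φ) (hψ : IsTest Ω ψ) :
    IsTest Ω (φ + ψ) where
  smooth := hφ.smooth.add hψ.smooth
  compact := hφ.compact.add hψ.compact
  supp := (tsupport_add φ ψ).trans (Set.union_subset hφ.supp hψ.supp)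

theorem IsTest.smooth_mul {φ ψ : Coord n → ℝ} (hψ : ContDiff ℝ ∞ ψ) (hφ : IsTest Ω φ) :
    IsTest Ω (ψ * φ) where
  smooth := hψ.mul hφ.smooth
  compact := hφ.compact.mul_left
  supp := (tsupport_mul_subset_right).trans hφ.supp

theorem IsTest.smul (c : ℝ) {φ : Coord n → ℝ} (hφ : IsTest Ω φ) : IsTest Ω (c • φ) :=
  IsTest.smooth_mul (ψ := fun _ => c) contDiff_const hφ

theorem IsTest.pd (a : Fin n) {φ : Coord n → ℝ} (hφ : IsTest Ω φ) : IsTest Ω (pd a φ) where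
  smooth := (hφ.smooth.fderiv_right (m := ∞) (by simp)).clm_apply contDiff_const
  compact := hφ.compact.fderiv_apply ℝ _
  supp := (tsupport_fderiv_apply_subset ℝ _).trans hφ.supp

theorem IsTest.sum {ι : Type*} (s : Finset ι) {φ : ι → Coord n → ℝ}
    (hφ : ∀ i ∈ s, IsTest Ω (φ i)) : IsTest Ω (∑ i ∈ s, φ i) :=
  Finset.sum_induction φ (IsTest Ω) (fun _ _ => IsTest.add) IsTest.zero hφ

theorem IsTest.hypLap {φ : Coord n → ℝ} (hφ : IsTest Ω φ) : IsTest Ω (hypLap φ) := by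
  have h1 : IsTest Ω ((fun x => height x ^ 2) *
      ∑ j ∈ Finset.univ, HypClamped.pd j (HypClamped.pd j φ)) :=
    IsTest.smooth_mul (contDiff_height.pow 2) (IsTest.sum _ fun j _ => (hφ.pd j).pd j)
  have h2 : IsTest Ω ((fun x => (2 - (n : ℝ)) * height x) * HypClamped.pd (lastIdx n) φ) :=
    IsTest.smooth_mul (contDiff_const.mul contDiff_height) (hφ.pd _)
  have h3 : HypClamped.hypLap φ = (fun x => height x ^ 2) *
      ∑ j ∈ Finset.univ, HypClamped.pd j (HypClamped.pd j φ) +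
      (fun x => (2 - (n : ℝ)) * height x) * HypClamped.pd (lastIdx n) φ := by
    funext x
    simp [HypClamped.hypLap]
  rw [h3]
  exact h1.add h2

theorem IsTest.memLp {φ : Coord n → ℝ} (hφ : IsTest Ω φ) : MemLp φ 2 (vol Ω) := by
  have hc : Continuous φ := hφ.smooth.continuous
  have hh : Continuous (height : Coord n → ℝ) := contDiff_height.continuous
  refine MemLp.restrict _ ?_
  rw [memLp_two_iff_integrable_sq hc.aestronglyMeasurable]
  rw [integrable_withDensity_iff_integrable_smul' (by fun_prop) (by simp)]
  have hcomp : HasCompactSupport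
      (fun x => (ENNReal.ofReal ((height x ^ n)⁻¹)).toReal • φ x ^ 2) := by
    refine hφ.compact.mono' ?_
    refine (Function.support_subset_iff'.2 fun x hx => ?_)
    have : φ x = 0 := image_eq_zero_of_notMem_tsupport hx
    simp [this]
  refine Continuous.integrable_of_hasCompactSupport ?_ hcomp
  rw [continuous_iff_continuousAt]
  intro x
  by_cases hx : x ∈ tsupport φ
  · have hpos : 0 < height x := Ω.subset_halfSpace (hφ.supp hx)
    have h1 : ContinuousAt (fun x : Coord n => (height x ^ n)⁻¹) x :=
      (hh.continuousAt.pow n).inv₀ (pow_pos hpos n).ne'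
    simp only [ENNReal.toReal_ofReal']
    exact (h1.max continuousAt_const).smul (hc.continuousAt.pow 2)
  · have h0 : φ =ᶠ[𝓝 x] 0 := notMem_tsupport_iff_eventuallyEq.1 hx
    have : (fun x => (ENNReal.ofReal ((height x ^ n)⁻¹)).toReal • φ x ^ 2) =ᶠ[𝓝 x]
        fun _ => (0 : ℝ) := by
      filter_upwards [h0] with y hy
      simp [hy]
    exact (continuousAt_const (y := (0 : ℝ))).congr this.symm

theorem L2Lim.zero {α : Type*} [MeasurableSpace α] {μ : Measure α} :
    L2Lim μ (fun _ => (0 : α → ℝ)) ((0 : Lp ℝ 2 μ) : α → ℝ) := by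
  have : ∀ _ : ℕ, eLpNorm ((0 : α → ℝ) - ((0 : Lp ℝ 2 μ) : α → ℝ)) 2 μ = 0 := by
    intro _
    rw [eLpNorm_congr_ae (g := (0 : α → ℝ)), eLpNorm_zero]
    filter_upwards [Lp.coeFn_zero ℝ 2 μ] with x hx
    rw [Pi.sub_apply, hx, sub_self]
    rfl
  exact tendsto_const_nhds.congr fun j => (this j).symm

theorem L2Lim.add {α : Type*} [MeasurableSpace α] {μ : Measure α} {F G : ℕ → α → ℝ}
    {u v : Lp ℝ 2 μ} (hF : ∀ j, MemLp (F j) 2 μ) (hG : ∀ j, MemLp (G j) 2 μ)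
    (hu : L2Lim μ F u) (hv : L2Lim μ G v) :
    L2Lim μ (fun j => F j + G j) ((u + v : Lp ℝ 2 μ) : α → ℝ) := by
  have hs := Tendsto.add hu hv
  rw [add_zero] at hs
  refine tendsto_of_tendsto_of_tendsto_of_le_of_le tendsto_const_nhds hs (fun _ => zero_le) ?_
  intro j
  refine le_trans (le_of_eq ?_) (eLpNorm_add_le (((hF j).sub (Lp.memLp u)).aestronglyMeasurable)
    (((hG j).sub (Lp.memLp v)).aestronglyMeasurable) (by norm_num))
  refine eLpNorm_congr_ae ?_
  filter_upwards [Lp.coeFn_add u v] with x hx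
  simp only [Pi.sub_apply, Pi.add_apply, hx]
  ring

theorem L2Lim.smul {α : Type*} [MeasurableSpace α] {μ : Measure α} {F : ℕ → α → ℝ}
    {u : Lp ℝ 2 μ} (c : ℝ) (hu : L2Lim μ F u) :
    L2Lim μ (fun j => c • F j) ((c • u : Lp ℝ 2 μ) : α → ℝ) := by
  have hs := ENNReal.Tendsto.const_mul (a := ‖c‖ₑ) hu (Or.inr (by simp))
  rw [mul_zero] at hs
  refine hs.congr fun j => ?_
  rw [← eLpNorm_const_smul]
  refine eLpNorm_congr_ae ?_
  filter_upwards [Lp.coeFn_smul c u] with x hx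
  simp only [Pi.sub_apply, Pi.smul_apply, hx, smul_eq_mul]
  ring

theorem MemH20.zero : MemH20 Ω 0 := by
  have hp : ∀ a : Fin n, pd a (0 : Coord n → ℝ) = 0 := by
    intro a
    funext x
    simp [pd]
  refine ⟨fun _ => 0, 0, 0, fun _ => IsTest.zero, L2Lim.zero, fun a => ?_, fun a b => ?_⟩
  · simp only [hp]
    exact L2Lim.zero
  · simp only [hp]
    exact L2Lim.zero

theorem MemH20.add {u v : Lp ℝ 2 (vol Ω)} (hu : MemH20 Ω u) (hv : MemH20 Ω v) :
    MemH20 Ω (u + v) := by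
  obtain ⟨φ, d₁, d₂, hφ, h0, h1, h2⟩ := hu
  obtain ⟨ψ, e₁, e₂, hψ, k0, k1, k2⟩ := hv
  refine ⟨fun j => φ j + ψ j, d₁ + e₁, d₂ + e₂, fun j => (hφ j).add (hψ j),
    h0.add (fun j => (hφ j).memLp) (fun j => (hψ j).memLp) k0, fun a => ?_, fun a b => ?_⟩
  · simp only [pd_add a (hφ _).smooth (hψ _).smooth]
    exact (h1 a).add (fun j => ((hφ j).pd a).memLp) (fun j => ((hψ j).pd a).memLp) (k1 a)
  · simp only [pd_add b (hφ _).smooth (hψ _).smooth,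
      pd_add a ((hφ _).pd b).smooth ((hψ _).pd b).smooth]
    exact (h2 a b).add (fun j => (((hφ j).pd b).pd a).memLp)
      (fun j => (((hψ j).pd b).pd a).memLp) (k2 a b)

theorem MemH20.smul (c : ℝ) {u : Lp ℝ 2 (vol Ω)} (hu : MemH20 Ω u) : MemH20 Ω (c • u) := by
  obtain ⟨φ, d₁, d₂, hφ, h0, h1, h2⟩ := hu
  refine ⟨fun j => c • φ j, c • d₁, c • d₂, fun j => (hφ j).smul c, h0.smul c,
    fun a => ?_, fun a b => ?_⟩
  · simp only [pd_smul a c (hφ _).smooth]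
    exact (h1 a).smul c
  · simp only [pd_smul b c (hφ _).smooth, pd_smul a c ((hφ _).pd b).smooth]
    exact (h2 a b).smul c

theorem integral_add_mul (u v : Lp ℝ 2 (vol Ω)) {φ : Coord n → ℝ} (hφ : IsTest Ω φ) :
    ∫ x, (u + v : Lp ℝ 2 (vol Ω)) x * φ x ∂(vol Ω) =
      ∫ x, u x * φ x ∂(vol Ω) + ∫ x, v x * φ x ∂(vol Ω) := by
  have hu : Integrable (fun x => u x * φ x) (vol Ω) := (Lp.memLp u).integrable_mul hφ.memLp
  have hv : Integrable (fun x => v x * φ x) (vol Ω) := (Lp.memLp v).integrable_mul hφ.memLp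
  rw [← integral_add hu hv]
  refine integral_congr_ae ?_
  filter_upwards [Lp.coeFn_add u v] with x hx
  simp only [hx, Pi.add_apply, add_mul]

theorem integral_smul_mul (c : ℝ) (u : Lp ℝ 2 (vol Ω)) (φ : Coord n → ℝ) :
    ∫ x, (c • u : Lp ℝ 2 (vol Ω)) x * φ x ∂(vol Ω) = c * ∫ x, u x * φ x ∂(vol Ω) := by
  rw [← integral_const_mul]
  refine integral_congr_ae ?_
  filter_upwards [Lp.coeFn_smul c u] with x hx
  simp only [hx, Pi.smul_apply, smul_eq_mul, mul_assoc]

theorem integral_zero_mul (φ : Coord n → ℝ) :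
    ∫ x, (0 : Lp ℝ 2 (vol Ω)) x * φ x ∂(vol Ω) = 0 := by
  refine integral_eq_zero_of_ae ?_
  filter_upwards [Lp.coeFn_zero ℝ 2 (vol Ω)] with x hx
  rw [hx, Pi.zero_apply, zero_mul]

end Helpers

/-! ### The clamped plate problem -/

/-- The solution space of the clamped plate problem with eigenvalue parameter `μ`:
`Δ²u = μ u` in `Ω` and `u = ∂u/∂ν = 0` on `∂Ω`, the boundary condition being `u ∈ H²₀(Ω)`.
The number `μ` is an eigenvalue when this space is not zero, and its dimension is the
multiplicity of `μ`. -/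
def clampedEigenspace {n : ℕ} [NeZero n] (Ω : BoundedDomain n) (μ : ℝ) :
    Submodule ℝ (Lp ℝ 2 (vol Ω)) where
  carrier := {u | MemH20 Ω u ∧ SolvesBiharm Ω μ u}
  zero_mem' := ⟨MemH20.zero, fun φ _ => by rw [integral_zero_mul, integral_zero_mul, mul_zero]⟩
  add_mem' := fun {u v} hu hv => ⟨hu.1.add hv.1, fun φ hφ => by
    rw [integral_add_mul u v hφ.hypLap.hypLap, integral_add_mul u v hφ, hu.2 φ hφ, hv.2 φ hφ,
      mul_add]⟩
  smul_mem' := fun c u hu => ⟨hu.1.smul c, fun φ hφ => by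
    rw [integral_smul_mul, integral_smul_mul, hu.2 φ hφ, mul_left_comm]⟩

/-- `lam 1 ≤ lam 2 ≤ ⋯` is the list of all eigenvalues of the clamped plate problem on `Ω`,
each repeated according to its multiplicity. The value `lam 0` plays no role. -/
structure IsClampedSpectrum {n : ℕ} [NeZero n] (Ω : BoundedDomain n) (lam : ℕ → ℝ) : Prop where
  mono : ∀ i j, 1 ≤ i → i ≤ j → lam i ≤ lam j
  mult : ∀ μ : ℝ, Cardinal.mk {i : ℕ // 1 ≤ i ∧ lam i = μ} =
    Module.rank ℝ (clampedEigenspace Ω μ)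

/-- The class `ℑ_lam` of pairs of functions on `]0, lam[` (the values of `f` and `g` outside
this interval play no role). -/
structure InClass (lam : ℝ) (f g : ℝ → ℝ) : Prop where
  f_pos : ∀ x ∈ Set.Ioo 0 lam, 0 < f x
  g_pos : ∀ x ∈ Set.Ioo 0 lam, 0 < g x
  cond : ∀ x ∈ Set.Ioo 0 lam, ∀ y ∈ Set.Ioo 0 lam, x ≠ y →
    ((f x - f y) / (x - y)) ^ 2 +
      (f x ^ 2 / (g x * (lam - x)) + f y ^ 2 / (g y * (lam - y))) * ((g x - g y) / (x - y)) ≤ 0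

end

end HypClamped

/-! ### The commutator inequality in an abstract Hilbert space. -/

namespace HypClamped

open scoped RealInnerProductSpace

/-! The proof is a commutator argument with the single multiplier F = log x_n. The operator b = [Δ,
F] = 2 x_n ∂_n + (1 - n) is skew for the hyperbolic volume, and [b, F] = 2. Take orthonormal
eigenfunctions u_1, …, u_k, write Λ = λ_{k+1}, and put r_ij = ⟨F u_i, u_j⟩ (symmetric) and t_ij = ⟨b
u_i, u_j⟩ (antisymmetric). The trial functions Φ_i = F u_i - ∑_j r_ij u_j are orthogonal to all u_j,
so Λ ‖Φ_i‖² ≤ ‖Δ Φ_i‖². Expanding the right side gives (Λ - λ_i) ‖Φ_i‖² ≤ ‖b u_i‖² - 2⟨Δu_i, u_i⟩ +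
∑_j (λ_i - λ_j) r_ij².

On the other hand [b, F] = 2 yields 1 + ∑_j r_ij t_ij = -⟨b u_i - ∑_j t_ij u_j, Φ_i⟩. Young's
inequality with weights built from f, g and a free α > 0, summed over i, leaves double sums in r and
t. Pairing (i, j) with (j, i) turns these into quadratic forms in (r_ij, t_ij), and the condition
defining the class says exactly that they are nonpositive (`InClass.sum_cross_le`). Optimising α
gives the product of square roots. The constants come from the Hardy inequality ‖b u‖² + (n-1)² ‖u‖²
≤ 4 ‖∇u‖² and from ‖∇u_i‖² = -⟨Δu_i, u_i⟩ ≤ √λ_i. This is `sum_le_of_commutator`.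

Unbounded operators are replaced by one closed subspace `graph Ω`, the closure of the triples (φ,
bφ, Δφ) over test functions; identities and inequalities pass to it by continuity. An elliptic
estimate identifies its first components with H²₀(Ω).

The eigenvalues are given only as a list with multiplicities, so the Rayleigh bound for Φ_i must be
proved. If it failed on the orthogonal complement of the u_i, Rellich compactness would give a
minimiser there (`exists_eigenvector_of_rayleigh_lt`), which is an eigenfunction with eigenvalue
below Λ. But the u_i already span all such eigenspaces. -/

/-- If `S ≤ (α P + Q / α) / 2` for all `α > 0`, then `S ≤ √P √Q`. -/
theorem le_sqrt_mul_sqrt_of_forall_pos {S P Q : ℝ} (hP : 0 ≤ P) (hQ : 0 ≤ Q)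
    (h : ∀ α : ℝ, 0 < α → 2 * S ≤ α * P + Q / α) : S ≤ √P * √Q := by
  rcases hP.eq_or_lt with rfl | hP'
  · simp only [Real.sqrt_zero, zero_mul]
    by_contra! hS
    -- Any large `α` contradicts `S > 0`; this one makes `Q / α ≤ S`, and the `+ 1` keeps it
    -- positive when `Q = 0`.
    have h1 := h ((Q + 1) / S) (by positivity)
    have h2 : Q / ((Q + 1) / S) ≤ S := by
      rw [div_div_eq_mul_div, div_le_iff₀ (by positivity)]
      nlinarith
    nlinarith
  rcases hQ.eq_or_lt with rfl | hQ'
  · simp only [Real.sqrt_zero, mul_zero]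
    by_contra! hS
    have h1 := h (S / P) (by positivity)
    rw [div_mul_cancel₀ _ hP'.ne', zero_div] at h1
    linarith
  · have hp := Real.sqrt_pos.2 hP'
    have hq := Real.sqrt_pos.2 hQ'
    -- The minimiser of `α P + Q / α`.
    have h1 := h (√Q / √P) (by positivity)
    have h2 : √Q / √P * P = √P * √Q := by
      rw [div_mul_eq_mul_div, div_eq_iff hp.ne']
      nlinarith [Real.mul_self_sqrt hP]
    have h3 : Q / (√Q / √P) = √P * √Q := by
      rw [div_div_eq_mul_div, div_eq_iff hq.ne']
      nlinarith [Real.mul_self_sqrt hQ]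
    linarith

/-- The symmetrisation that the class `ℑ_Λ` is made for. -/
theorem InClass.sum_cross_le {Λ : ℝ} {f g : ℝ → ℝ} (hfg : InClass Λ f g) {ι : Type*} [Fintype ι]
    {l : ι → ℝ} (hl : ∀ i, l i ∈ Set.Ioo 0 Λ) {r t : ι → ι → ℝ} (hr : ∀ i j, r i j = r j i)
    (ht : ∀ i j, t i j = -t j i) {α : ℝ} (hα : 0 < α) :
    α * ∑ i, ∑ j, g (l i) * (l i - l j) * r i j ^ 2 -
      (∑ i, ∑ j, f (l i) ^ 2 / (g (l i) * (Λ - l i)) * t i j ^ 2) / α -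
      2 * ∑ i, ∑ j, f (l i) * (r i j * t i j) ≤ 0 := by
  have key : ∀ i j, α * (g (l i) * (l i - l j) * r i j ^ 2 + g (l j) * (l j - l i) * r j i ^ 2) -
      (f (l i) ^ 2 / (g (l i) * (Λ - l i)) * t i j ^ 2 +
        f (l j) ^ 2 / (g (l j) * (Λ - l j)) * t j i ^ 2) / α -
      2 * (f (l i) * (r i j * t i j) + f (l j) * (r j i * t j i)) ≤ 0 := by
    intro i j
    rw [hr j i, ht j i]
    have hi := hl i
    have hj := hl j
    set x := l i
    set y := l j
    have hgx := hfg.g_pos x hi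
    have hgy := hfg.g_pos y hj
    have hfx := hfg.f_pos x hi
    have hfy := hfg.f_pos y hj
    have hcx : 0 < f x ^ 2 / (g x * (Λ - x)) :=
      div_pos (by positivity) (mul_pos hgx (sub_pos.2 hi.2))
    have hcy : 0 < f y ^ 2 / (g y * (Λ - y)) :=
      div_pos (by positivity) (mul_pos hgy (sub_pos.2 hj.2))
    -- The class condition is silent on the diagonal, but there the `r` terms and the cross terms
    -- cancel and only a nonpositive `t` term is left.
    by_cases hxy : x = y
    · rw [hxy] at hcx ⊢
      have : 0 ≤ (f y ^ 2 / (g y * (Λ - y)) * t i j ^ 2 +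
        f y ^ 2 / (g y * (Λ - y)) * t i j ^ 2) / α := by positivity
      rw [neg_sq]
      simp only [sub_self, mul_zero, zero_mul, add_zero]
      linarith
    have hc := hfg.cond x hi y hj hxy
    set C := f x ^ 2 / (g x * (Λ - x)) + f y ^ 2 / (g y * (Λ - y)) with hC
    have hCpos : 0 < C := add_pos hcx hcy
    have hs : x - y ≠ 0 := sub_ne_zero.2 hxy
    have hc2 : (f x - f y) ^ 2 + C * ((g x - g y) * (x - y)) ≤ 0 := by
      have : (f x - f y) ^ 2 + C * ((g x - g y) * (x - y)) =
          (((f x - f y) / (x - y)) ^ 2 + C * ((g x - g y) / (x - y))) * (x - y) ^ 2 := by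
        field_simp
      rw [this]
      exact mul_nonpos_of_nonpos_of_nonneg hc (sq_nonneg _)
    -- After multiplication by `α C` and use of `hc2`, the paired term is at most minus this square:
    -- the class condition is a discriminant condition.
    have hsq : 0 ≤ (α * (f x - f y) * r i j + C * t i j) ^ 2 := sq_nonneg _
    have hfin : (α * (g x * (x - y) * r i j ^ 2 + g y * (y - x) * r i j ^ 2) -
      (f x ^ 2 / (g x * (Λ - x)) * t i j ^ 2 +
        f y ^ 2 / (g y * (Λ - y)) * (-t i j) ^ 2) / α -
      2 * (f x * (r i j * t i j) + f y * (r i j * -t i j))) * (α * C) =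
      α ^ 2 * r i j ^ 2 * (C * ((g x - g y) * (x - y))) - C ^ 2 * t i j ^ 2 -
        2 * α * C * (f x - f y) * (r i j * t i j) := by
      rw [show f x ^ 2 / (g x * (Λ - x)) * t i j ^ 2 +
        f y ^ 2 / (g y * (Λ - y)) * (-t i j) ^ 2 = C * t i j ^ 2 by rw [hC]; ring]
      field_simp
      ring
    have hle : α ^ 2 * r i j ^ 2 * (C * ((g x - g y) * (x - y))) - C ^ 2 * t i j ^ 2 -
        2 * α * C * (f x - f y) * (r i j * t i j) ≤ 0 := by
      have : 0 ≤ α ^ 2 * r i j ^ 2 := by positivity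
      nlinarith
    rw [← hfin] at hle
    exact nonpos_of_mul_nonpos_left hle (mul_pos hα hCpos)
  have hsum : ∑ i, ∑ j, (α * (g (l i) * (l i - l j) * r i j ^ 2 +
      g (l j) * (l j - l i) * r j i ^ 2) -
      (f (l i) ^ 2 / (g (l i) * (Λ - l i)) * t i j ^ 2 +
        f (l j) ^ 2 / (g (l j) * (Λ - l j)) * t j i ^ 2) / α -
      2 * (f (l i) * (r i j * t i j) + f (l j) * (r j i * t j i))) ≤ 0 :=
    Finset.sum_nonpos fun i _ => Finset.sum_nonpos fun j _ => key i j
  -- Exchanging the indices turns the second half of each pair into the first, so `hsum` is twice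
  -- the claim.
  have e1 := Finset.sum_comm (s := Finset.univ) (t := Finset.univ)
    (f := fun i j => g (l j) * (l j - l i) * r j i ^ 2)
  have e2 := Finset.sum_comm (s := Finset.univ) (t := Finset.univ)
    (f := fun i j => f (l j) ^ 2 / (g (l j) * (Λ - l j)) * t j i ^ 2)
  have e3 := Finset.sum_comm (s := Finset.univ) (t := Finset.univ)
    (f := fun i j => f (l j) * (r j i * t j i))
  simp only [Finset.sum_sub_distrib, ← Finset.mul_sum, ← Finset.sum_div,
    Finset.sum_add_distrib, mul_assoc] at hsum e1 e2 e3 ⊢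
  rw [e1, e2, e3] at hsum
  rw [add_div] at hsum
  linarith

/-- The numerical part of the commutator argument. -/
theorem InClass.sum_le {Λ : ℝ} {f g : ℝ → ℝ} (hfg : InClass Λ f g) {ι : Type*} [Fintype ι]
    {l : ι → ℝ} (hl : ∀ i, l i ∈ Set.Ioo 0 Λ) {r t : ι → ι → ℝ} (hr : ∀ i j, r i j = r j i)
    (ht : ∀ i j, t i j = -t j i) {p q w b : ι → ℝ} (hw : ∀ i, 0 ≤ w i) (hb : ∀ i, 0 ≤ b i)
    (hp : ∀ i, (Λ - l i) * p i ^ 2 ≤ w i + ∑ j, (l i - l j) * r i j ^ 2)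
    (hq : ∀ i, q i ^ 2 ≤ b i - ∑ j, t i j ^ 2)
    (hpq : ∀ i, 1 + ∑ j, r i j * t i j ≤ q i * p i) :
    ∑ i, f (l i) ≤ √(∑ i, g (l i) * w i) *
      √(∑ i, f (l i) ^ 2 / (g (l i) * (Λ - l i)) * b i) := by
  have hg := fun i => hfg.g_pos _ (hl i)
  have hf := fun i => hfg.f_pos _ (hl i)
  have hΛ : ∀ i, 0 < Λ - l i := fun i => sub_pos.2 (hl i).2
  have hc : ∀ i, 0 < f (l i) ^ 2 / (g (l i) * (Λ - l i)) := fun i =>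
    div_pos (pow_pos (hf i) 2) (mul_pos (hg i) (hΛ i))
  refine le_sqrt_mul_sqrt_of_forall_pos (Finset.sum_nonneg fun i _ => mul_nonneg (hg i).le (hw i))
    (Finset.sum_nonneg fun i _ => mul_nonneg (hc i).le (hb i)) fun α hα => ?_
  have key : ∀ i, 2 * (f (l i) + ∑ j, f (l i) * (r i j * t i j)) ≤
      α * (g (l i) * w i + ∑ j, g (l i) * (l i - l j) * r i j ^ 2) +
      (f (l i) ^ 2 / (g (l i) * (Λ - l i)) * b i -
        ∑ j, f (l i) ^ 2 / (g (l i) * (Λ - l i)) * t i j ^ 2) / α := by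
    intro i
    have e1 : f (l i) + ∑ j, f (l i) * (r i j * t i j) = f (l i) * (1 + ∑ j, r i j * t i j) := by
      rw [← Finset.mul_sum]; ring
    have e2 : g (l i) * w i + ∑ j, g (l i) * (l i - l j) * r i j ^ 2 =
        g (l i) * (w i + ∑ j, (l i - l j) * r i j ^ 2) := by
      rw [mul_add, Finset.mul_sum]; simp only [mul_assoc]
    have e3 : f (l i) ^ 2 / (g (l i) * (Λ - l i)) * b i -
        ∑ j, f (l i) ^ 2 / (g (l i) * (Λ - l i)) * t i j ^ 2 =
        f (l i) ^ 2 / (g (l i) * (Λ - l i)) * (b i - ∑ j, t i j ^ 2) := by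
      rw [mul_sub (f (l i) ^ 2 / (g (l i) * (Λ - l i))), Finset.mul_sum]
    rw [e1, e2, e3]
    -- Young's inequality with weight `α g (Λ - l)`, which leaves `p ^ 2` and `q ^ 2` with the very
    -- factors that `hp` and `hq` bound.
    have h1 : 2 * (f (l i) * (q i * p i)) ≤ α * (g (l i) * ((Λ - l i) * p i ^ 2)) +
        f (l i) ^ 2 / (g (l i) * (Λ - l i)) * q i ^ 2 / α := by
      have hk : 0 < α * g (l i) * (Λ - l i) := mul_pos (mul_pos hα (hg i)) (hΛ i)
      have := div_nonneg (sq_nonneg (α * g (l i) * (Λ - l i) * p i - f (l i) * q i)) hk.le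
      have e : (α * g (l i) * (Λ - l i) * p i - f (l i) * q i) ^ 2 / (α * g (l i) * (Λ - l i)) =
          α * (g (l i) * ((Λ - l i) * p i ^ 2)) +
        f (l i) ^ 2 / (g (l i) * (Λ - l i)) * q i ^ 2 / α - 2 * (f (l i) * (q i * p i)) := by
        have h1 := hα.ne'
        have h2 := (hg i).ne'
        have h3 := (hΛ i).ne'
        field_simp
        ring
      linarith
    have h2 := mul_le_mul_of_nonneg_left (hpq i) (hf i).le
    have h3 := mul_le_mul_of_nonneg_left (hp i) (mul_pos hα (hg i)).le
    have h4 := div_le_div_of_nonneg_right (mul_le_mul_of_nonneg_left (hq i) (hc i).le) hα.le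
    linarith
  have hsum := Finset.sum_le_sum fun i (_ : i ∈ Finset.univ) => key i
  have hx := hfg.sum_cross_le hl hr ht hα
  simp only [Finset.sum_sub_distrib, ← Finset.mul_sum, ← Finset.sum_div,
    Finset.sum_add_distrib, mul_assoc] at hsum hx ⊢
  rw [sub_div] at hsum
  linarith

/-- The universal inequality in Hilbert space form: `Γ` is the graph `{(u, b u, ℓ u)}` of a
skew operator `b` and of an operator `ℓ`, `F` is a bounded symmetric operator with
`[ℓ, F] = b` and `[b, F] = 2`, and the `X i` are orthonormal eigenvectors of `ℓ²`. -/
theorem sum_le_of_commutator {H : Type*} [NormedAddCommGroup H] [InnerProductSpace ℝ H]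
    (Γ : Submodule ℝ (H × H × H)) (F : H →ₗ[ℝ] H) (hF : ∀ x y, ⟪F x, y⟫ = ⟪x, F y⟫)
    (hskew : ∀ X ∈ Γ, ∀ Y ∈ Γ, ⟪X.2.1, Y.1⟫ = -⟪X.1, Y.2.1⟫)
    (hmul : ∀ X ∈ Γ, (F X.1, F X.2.1 + (2 : ℝ) • X.1, F X.2.2 + X.2.1) ∈ Γ)
    {c : ℝ} (hgrad : ∀ X ∈ Γ, ‖X.2.1‖ ^ 2 + c * ‖X.1‖ ^ 2 ≤ -4 * ⟪X.2.2, X.1⟫)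
    {ι : Type*} [Fintype ι] {X : ι → H × H × H} (hX : ∀ i, X i ∈ Γ)
    (hon : Orthonormal ℝ fun i => (X i).1) {l : ι → ℝ} {Λ : ℝ} (hl : ∀ i, l i ∈ Set.Ioo 0 Λ)
    (heig : ∀ i, ∀ Y ∈ Γ, ⟪(X i).2.2, Y.2.2⟫ = l i * ⟪(X i).1, Y.1⟫)
    (hvar : ∀ Y ∈ Γ, (∀ i, ⟪(X i).1, Y.1⟫ = 0) → Λ * ‖Y.1‖ ^ 2 ≤ ‖Y.2.2‖ ^ 2)
    {f g : ℝ → ℝ} (hfg : InClass Λ f g) :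
    ∑ i, f (l i) ≤ √(∑ i, g (l i) * (6 * √(l i) - c)) *
      √(∑ i, f (l i) ^ 2 / (g (l i) * (Λ - l i)) * (4 * √(l i) - c)) := by
  classical
  have hu : ∀ i, ‖(X i).1‖ = 1 := hon.1
  have hij : ∀ i j, ⟪(X i).1, (X j).1⟫ = if i = j then (1 : ℝ) else 0 :=
    orthonormal_iff_ite.1 hon
  have hlX : ∀ i, ‖(X i).2.2‖ = √(l i) := fun i => by
    have := heig i _ (hX i)
    rw [real_inner_self_eq_norm_sq, real_inner_self_eq_norm_sq, hu, one_pow, mul_one] at this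
    rw [← this, Real.sqrt_sq (norm_nonneg _)]
  have hlu : ∀ i, -⟪(X i).2.2, (X i).1⟫ ≤ √(l i) := fun i => by
    have := (abs_le.1 (abs_real_inner_le_norm (X i).2.2 (X i).1)).1
    rw [hlX, hu, mul_one] at this
    linarith
  have hgr : ∀ i, ‖(X i).2.1‖ ^ 2 + c ≤ -4 * ⟪(X i).2.2, (X i).1⟫ := fun i => by
    simpa [hu] using hgrad _ (hX i)
  set r : ι → ι → ℝ := fun i j => ⟪F (X i).1, (X j).1⟫ with hr
  set t : ι → ι → ℝ := fun i j => ⟪(X i).2.1, (X j).1⟫ with ht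
  have hrs : ∀ i j, r i j = r j i := fun i j => by
    simp only [hr]; rw [hF, real_inner_comm]
  have hts : ∀ i j, t i j = -t j i := fun i j => by
    simp only [ht]; rw [hskew _ (hX i) _ (hX j), real_inner_comm]
  set M : ι → H × H × H := fun i =>
    (F (X i).1, F (X i).2.1 + (2 : ℝ) • (X i).1, F (X i).2.2 + (X i).2.1) with hM
  have hMΓ : ∀ i, M i ∈ Γ := fun i => hmul _ (hX i)
  -- The trial vectors, built as whole triples so that membership in `Γ` is immediate and all three
  -- components are at hand.
  set Φ : ι → H × H × H := fun i => M i - ∑ j, r i j • X j with hΦ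
  have hΦΓ : ∀ i, Φ i ∈ Γ := fun i =>
    Γ.sub_mem (hMΓ i) (Γ.sum_mem fun j _ => Γ.smul_mem _ (hX j))
  have hΦ1 : ∀ i, (Φ i).1 = F (X i).1 - ∑ j, r i j • (X j).1 := fun i => by
    simp [hΦ, hM, Prod.fst_sum]
  have hΦ2 : ∀ i, (Φ i).2.2 = F (X i).2.2 + (X i).2.1 - ∑ j, r i j • (X j).2.2 := fun i => by
    simp [hΦ, hM, Prod.snd_sum]
  have hΦ3 : ∀ i, (Φ i).2.1 = F (X i).2.1 + (2 : ℝ) • (X i).1 - ∑ j, r i j • (X j).2.1 :=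
    fun i => by simp [hΦ, hM, Prod.snd_sum, Prod.fst_sum]
  have hperp : ∀ i j, ⟪(X j).1, (Φ i).1⟫ = 0 := fun i j => by
    rw [hΦ1, inner_sub_right, inner_sum]
    simp only [inner_smul_right, hij]
    simp [hr, real_inner_comm]
  -- the commutator form
  have hcomm : ∀ i, ∀ Y ∈ Γ, ⟪F (X i).2.2 + (X i).2.1, Y.2.2⟫ = l i * ⟪F (X i).1, Y.1⟫ +
      (⟪(X i).2.1, Y.2.2⟫ - ⟪(X i).2.2, Y.2.1⟫) := fun i Y hY => by
    have := heig i _ (hmul Y hY)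
    simp only [inner_add_right] at this
    rw [inner_add_left, hF, hF (X i).1]
    linarith
  have hp : ∀ i, (Λ - l i) * ‖(Φ i).1‖ ^ 2 ≤ (‖(X i).2.1‖ ^ 2 - 2 * ⟪(X i).2.2, (X i).1⟫) +
      ∑ j, (l i - l j) * r i j ^ 2 := fun i => by
    have h1 := hvar _ (hΦΓ i) (hperp i)
    have h2 : ‖(Φ i).2.2‖ ^ 2 = ⟪F (X i).2.2 + (X i).2.1, (Φ i).2.2⟫ := by
      rw [← real_inner_self_eq_norm_sq]
      nth_rewrite 1 [hΦ2]
      rw [inner_sub_left, sum_inner]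
      simp only [inner_smul_left, heig _ _ (hΦΓ i), hperp]
      simp
    have h3 : ‖(Φ i).1‖ ^ 2 = ⟪F (X i).1, (Φ i).1⟫ := by
      rw [← real_inner_self_eq_norm_sq]
      nth_rewrite 1 [hΦ1]
      rw [inner_sub_left, sum_inner]
      simp only [inner_smul_left, hperp]
      simp
    rw [hcomm i _ (hΦΓ i), ← h3] at h2
    have h4 : ⟪(X i).2.1, (Φ i).2.2⟫ - ⟪(X i).2.2, (Φ i).2.1⟫ =
        (⟪(X i).2.1, (M i).2.2⟫ - ⟪(X i).2.2, (M i).2.1⟫) -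
        ∑ j, r i j * (⟪(X i).2.1, (X j).2.2⟫ - ⟪(X i).2.2, (X j).2.1⟫) := by
      rw [hΦ2, hΦ3]
      simp only [inner_sub_right, inner_sum, inner_smul_right, mul_sub, Finset.sum_sub_distrib, hM]
      ring
    -- Evaluate ⟨ℓ F u_i, ℓ u_j⟩ twice: through the equation for `X i` and through the one for `X
    -- j`.
    have h5 : ∀ j, ⟪(X i).2.1, (X j).2.2⟫ - ⟪(X i).2.2, (X j).2.1⟫ = (l j - l i) * r i j := by
      intro j
      have e1 := hcomm i _ (hX j)
      have e2 := heig j _ (hMΓ i)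
      rw [real_inner_comm] at e2
      simp only [hM] at e2
      rw [e2, real_inner_comm] at e1
      simp only [hr]
      linarith
    -- The terms with `F` cancel by symmetry; the rest comes from [ℓ, F] = b and [b, F] = 2.
    have h6 : ⟪(X i).2.1, (M i).2.2⟫ - ⟪(X i).2.2, (M i).2.1⟫ =
        ‖(X i).2.1‖ ^ 2 - 2 * ⟪(X i).2.2, (X i).1⟫ := by
      simp only [hM, inner_add_right, inner_smul_right]
      rw [real_inner_self_eq_norm_sq, ← hF, real_inner_comm]
      ring
    rw [h4, h6] at h2
    simp only [h5] at h2
    have h7 : ∑ j, (l i - l j) * r i j ^ 2 = -∑ j, r i j * ((l j - l i) * r i j) := by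
      rw [← Finset.sum_neg_distrib]
      exact Finset.sum_congr rfl fun j _ => by ring
    rw [h7]
    linarith
  have hq : ∀ i, ‖(X i).2.1 - ∑ j, t i j • (X j).1‖ ^ 2 ≤ ‖(X i).2.1‖ ^ 2 - ∑ j, t i j ^ 2 :=
    fun i => by
    have hS : ⟪∑ j, t i j • (X j).1, ∑ j, t i j • (X j).1⟫ = ∑ j, t i j ^ 2 := by
      rw [hon.inner_sum]
      simp [sq]
    have hS2 : ⟪(X i).2.1, ∑ j, t i j • (X j).1⟫ = ∑ j, t i j ^ 2 := by
      rw [inner_sum]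
      simp [inner_smul_right, sq, ht]
    rw [norm_sub_sq_real, hS2, ← real_inner_self_eq_norm_sq (∑ j, t i j • (X j).1), hS]
    linarith
  have hpq : ∀ i, 1 + ∑ j, r i j * t i j ≤
      ‖(X i).2.1 - ∑ j, t i j • (X j).1‖ * ‖(Φ i).1‖ := fun i => by
    -- Skewness of b and [b, F] = 2 give 2⟨b u, F u⟩ = -2‖u‖². Subtracting the projection of b u
    -- costs nothing because `Φ i` is orthogonal to every `X j`.
    have h1 : ⟪(X i).2.1 - ∑ j, t i j • (X j).1, (Φ i).1⟫ = -(1 + ∑ j, r i j * t i j) := by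
      rw [inner_sub_left, sum_inner]
      simp only [inner_smul_left, hperp]
      rw [hΦ1, inner_sub_right, inner_sum]
      simp only [inner_smul_right]
      have h2 := hskew _ (hX i) _ (hMΓ i)
      simp only [hM, inner_add_right, inner_smul_right] at h2
      rw [real_inner_self_eq_norm_sq, hu, ← hF, real_inner_comm] at h2
      rw [real_inner_comm] at h2 ⊢
      have h4 : ⟪F (X i).1, (X i).2.1⟫ = ⟪F (X i).2.1, (X i).1⟫ := by rw [hF, real_inner_comm]
      simp only [ht]
      simp
      linarith
    have := (abs_le.1 (abs_real_inner_le_norm ((X i).2.1 - ∑ j, t i j • (X j).1) (Φ i).1)).1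
    rw [h1] at this
    linarith
  -- Since -⟨ℓu, u⟩ ≤ √l, the gradient bound gives ‖b u‖² ≤ 4√l - c, and adding -2⟨ℓu, u⟩ gives 6√l
  -- - c. The same bound makes both weights nonnegative.
  refine hfg.sum_le hl hrs hts (fun i => ?_) (fun i => ?_) (fun i => (hp i).trans ?_)
    (fun i => (hq i).trans ?_) hpq
  · nlinarith [hgr i, hlu i, sq_nonneg ‖(X i).2.1‖, Real.sqrt_nonneg (l i)]
  · nlinarith [hgr i, hlu i, sq_nonneg ‖(X i).2.1‖]
  · nlinarith [hgr i, hlu i]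
  · nlinarith [hgr i, hlu i]

end HypClamped

/-! ### The variational principle below the next eigenvalue. -/

namespace HypClamped

open scoped RealInnerProductSpace

theorem tendsto_zero_of_sq_le {α : Type*} {F : Filter α} {d e : α → ℝ} (hd : ∀ a, 0 ≤ d a)
    (hde : ∀ a, d a ^ 2 ≤ e a) (he : Tendsto e F (𝓝 0)) : Tendsto d F (𝓝 0) := by
  have h := (Real.continuous_sqrt.tendsto 0).comp he
  rw [Real.sqrt_zero] at h
  exact squeeze_zero hd (fun a => Real.le_sqrt_of_sq_le (hde a)) h

/-- A quadratic polynomial `a + b t + c t²` with `a = 0` that is nonnegative has `b = 0`. -/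
theorem eq_zero_of_forall_quadratic_nonneg {b c : ℝ} (h : ∀ t : ℝ, 0 ≤ b * t + c * t ^ 2) :
    b = 0 := by
  have h1 := discrim_le_zero (a := c) (b := b) (c := 0) fun t => by
    have := h t
    linarith
  rw [discrim] at h1
  nlinarith

variable {H : Type*} [NormedAddCommGroup H] [InnerProductSpace ℝ H]

/-- Existence of a minimiser of the Rayleigh quotient `‖ℓ u‖² / ‖u‖²` on the orthogonal
complement of finitely many eigenvectors; the minimiser is an eigenvector. -/
theorem exists_eigenvector_of_rayleigh_lt [CompleteSpace H] (Γ : Submodule ℝ (H × H × H))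
    (hcl : IsClosed (Γ : Set (H × H × H)))
    (hgrad : ∀ X ∈ Γ, ‖X.2.1‖ ^ 2 ≤ -4 * ⟪X.2.2, X.1⟫)
    (hcpt : TotallyBounded (Prod.fst '' {X : H × H × H | X ∈ Γ ∧ ‖X.2.2‖ ≤ 1}))
    {ι : Type*} [Fintype ι] {X : ι → H × H × H} (hX : ∀ i, X i ∈ Γ)
    (hon : Orthonormal ℝ fun i => (X i).1) {l : ι → ℝ}
    (heig : ∀ i, ∀ Y ∈ Γ, ⟪(X i).2.2, Y.2.2⟫ = l i * ⟪(X i).1, Y.1⟫)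
    {Λ : ℝ} {Y : H × H × H} (hY : Y ∈ Γ) (hYX : ∀ i, ⟪(X i).1, Y.1⟫ = 0)
    (hlt : ‖Y.2.2‖ ^ 2 < Λ * ‖Y.1‖ ^ 2) :
    ∃ m < Λ, ∃ Z ∈ Γ, (∀ i, ⟪(X i).1, Z.1⟫ = 0) ∧ ‖Z.1‖ = 1 ∧
      ∀ Y ∈ Γ, ⟪Z.2.2, Y.2.2⟫ = m * ⟪Z.1, Y.1⟫ := by
  classical
  set A : Set ℝ := {s | ∃ Z ∈ Γ, (∀ i, ⟪(X i).1, Z.1⟫ = 0) ∧ ‖Z.1‖ = 1 ∧ ‖Z.2.2‖ ^ 2 = s} with hA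
  have hbdd : BddBelow A := ⟨0, by rintro s ⟨Z, -, -, -, rfl⟩; positivity⟩
  have hscale : ∀ Z ∈ Γ, (∀ i, ⟪(X i).1, Z.1⟫ = 0) → Z.1 ≠ 0 → ‖Z.2.2‖ ^ 2 / ‖Z.1‖ ^ 2 ∈ A := by
    intro Z hZ hZX h0
    have hn : 0 < ‖Z.1‖ := norm_pos_iff.2 h0
    refine ⟨‖Z.1‖⁻¹ • Z, Γ.smul_mem _ hZ, fun i => ?_, ?_, ?_⟩
    · simp [inner_smul_right, hZX]
    · simp [norm_smul, hn.ne']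
    · simp only [Prod.smul_snd, norm_smul, norm_inv, norm_norm]
      field_simp
  have hY0 : Y.1 ≠ 0 := by
    intro h
    rw [h, norm_zero] at hlt
    nlinarith [sq_nonneg ‖Y.2.2‖]
  have hAne : A.Nonempty := ⟨_, hscale Y hY hYX hY0⟩
  set m := sInf A with hm
  have hmΛ : m < Λ := (csInf_le hbdd (hscale Y hY hYX hY0)).trans_lt
    ((div_lt_iff₀ (pow_pos (norm_pos_iff.2 hY0) 2)).2 hlt)
  have hmin : ∀ Z ∈ Γ, (∀ i, ⟪(X i).1, Z.1⟫ = 0) → m * ‖Z.1‖ ^ 2 ≤ ‖Z.2.2‖ ^ 2 := by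
    intro Z hZ hZX
    by_cases h0 : Z.1 = 0
    · simp only [h0, norm_zero]
      nlinarith [sq_nonneg ‖Z.2.2‖]
    · exact (le_div_iff₀ (pow_pos (norm_pos_iff.2 h0) 2)).1 (csInf_le hbdd (hscale Z hZ hZX h0))
  obtain ⟨s, -, hs, hsA⟩ := exists_seq_tendsto_sInf hAne hbdd
  choose Z hZ hZX hZ1 hZs using hsA
  obtain ⟨R, hR⟩ : ∃ R, ∀ j, s j ≤ R := by
    obtain ⟨R, hR⟩ := hs.bddAbove_range
    exact ⟨R, fun j => hR ⟨j, rfl⟩⟩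
  have hR0 : 0 ≤ R := (by rw [← hZs]; positivity : 0 ≤ s 0).trans (hR 0)
  have hRpos : 0 < √(R + 1) := Real.sqrt_pos.2 (by linarith)
  -- The minimising sequence is rescaled to satisfy ‖ℓ Z‖ ≤ 1, as the compactness hypothesis
  -- demands.
  have hsub : ∀ j, (√(R + 1))⁻¹ • (Z j).1 ∈
      closure (Prod.fst '' {X : H × H × H | X ∈ Γ ∧ ‖X.2.2‖ ≤ 1}) := fun j => by
    refine subset_closure ⟨(√(R + 1))⁻¹ • Z j, ⟨Γ.smul_mem _ (hZ j), ?_⟩, rfl⟩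
    rw [Prod.smul_snd, Prod.smul_snd, norm_smul, norm_inv, Real.norm_of_nonneg hRpos.le,
      inv_mul_le_one₀ hRpos]
    refine Real.le_sqrt_of_sq_le ?_
    rw [hZs]
    linarith [hR j]
  obtain ⟨v, -, ψ, hψ, hv⟩ := (hcpt.closure.isCompact_of_isClosed isClosed_closure).tendsto_subseq hsub
  have hu : Tendsto (fun j => (Z (ψ j)).1) atTop (𝓝 (√(R + 1) • v)) := by
    refine (hv.const_smul (√(R + 1))).congr fun j => ?_
    simp [smul_smul, hRpos.ne']
  generalize √(R + 1) • v = u at hu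
  have hsψ : Tendsto (fun j => s (ψ j)) atTop (𝓝 m) := hs.comp hψ.tendsto_atTop
  have hdu : Tendsto (fun p : ℕ × ℕ => dist (Z (ψ p.1)).1 (Z (ψ p.2)).1) atTop (𝓝 0) :=
    cauchySeq_iff_tendsto_dist_atTop_0.1 hu.cauchySeq
  -- By the parallelogram law and minimality at the sum, ‖ℓ(Z_p - Z_q)‖² ≤ 2s_p + 2s_q - m‖Z_p +
  -- Z_q‖², where ‖Z_p + Z_q‖² = 4 - ‖Z_p - Z_q‖². So convergence of the first components forces
  -- that of the third.
  have hdl : Tendsto (fun p : ℕ × ℕ => dist (Z (ψ p.1)).2.2 (Z (ψ p.2)).2.2) atTop (𝓝 0) := by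
    refine tendsto_zero_of_sq_le (fun _ => dist_nonneg)
      (e := fun p => 2 * s (ψ p.1) + 2 * s (ψ p.2) - 4 * m +
        m * dist (Z (ψ p.1)).1 (Z (ψ p.2)).1 ^ 2) (fun p => ?_) ?_
    · have h1 := parallelogram_law_with_norm ℝ (Z (ψ p.1)).2.2 (Z (ψ p.2)).2.2
      have h2 := parallelogram_law_with_norm ℝ (Z (ψ p.1)).1 (Z (ψ p.2)).1
      have h3 := hmin _ (Γ.add_mem (hZ (ψ p.1)) (hZ (ψ p.2))) fun i => by
        simp [inner_add_right, hZX]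
      rw [Prod.fst_add, Prod.snd_add, Prod.snd_add] at h3
      rw [dist_eq_norm, dist_eq_norm, ← hZs, ← hZs]
      rw [hZ1, hZ1] at h2
      have h4 : ‖(Z (ψ p.1)).1 + (Z (ψ p.2)).1‖ ^ 2 =
          4 - ‖(Z (ψ p.1)).1 - (Z (ψ p.2)).1‖ ^ 2 := by linarith
      rw [h4] at h3
      nlinarith
    · have hf : Tendsto (fun p : ℕ × ℕ => s (ψ p.1)) atTop (𝓝 m) := by
        rw [← prod_atTop_atTop_eq]
        exact hsψ.comp tendsto_fst
      have hg : Tendsto (fun p : ℕ × ℕ => s (ψ p.2)) atTop (𝓝 m) := by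
        rw [← prod_atTop_atTop_eq]
        exact hsψ.comp tendsto_snd
      have := (((hf.const_mul 2).add (hg.const_mul 2)).sub_const (4 * m)).add
        ((hdu.pow 2).const_mul m)
      convert this using 2
      ring
  have hdb : Tendsto (fun p : ℕ × ℕ => dist (Z (ψ p.1)).2.1 (Z (ψ p.2)).2.1) atTop (𝓝 0) := by
    refine tendsto_zero_of_sq_le (fun _ => dist_nonneg)
      (e := fun p => 4 * (dist (Z (ψ p.1)).2.2 (Z (ψ p.2)).2.2 *
        dist (Z (ψ p.1)).1 (Z (ψ p.2)).1)) (fun p => ?_) ?_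
    · have h1 := hgrad _ (Γ.sub_mem (hZ (ψ p.1)) (hZ (ψ p.2)))
      simp only [Prod.fst_sub, Prod.snd_sub] at h1
      have h2 := (abs_le.1 (abs_real_inner_le_norm ((Z (ψ p.1)).2.2 - (Z (ψ p.2)).2.2)
        ((Z (ψ p.1)).1 - (Z (ψ p.2)).1))).1
      rw [dist_eq_norm, dist_eq_norm, dist_eq_norm]
      linarith
    · simpa using (hdl.mul hdu).const_mul 4
  obtain ⟨w, hw⟩ := cauchySeq_tendsto_of_complete
    ((cauchySeq_iff_tendsto_dist_atTop_0 (u := fun j => (Z (ψ j)).2.2)).2 hdl)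
  obtain ⟨b, hb⟩ := cauchySeq_tendsto_of_complete
    ((cauchySeq_iff_tendsto_dist_atTop_0 (u := fun j => (Z (ψ j)).2.1)).2 hdb)
  have hlim : (u, b, w) ∈ Γ := hcl.mem_of_tendsto (hu.prodMk_nhds (hb.prodMk_nhds hw))
    (Eventually.of_forall fun j => hZ (ψ j))
  have hu1 : ‖u‖ = 1 := tendsto_nhds_unique hu.norm (by simp [hZ1])
  have huX : ∀ i, ⟪(X i).1, u⟫ = 0 := fun i =>
    tendsto_nhds_unique (tendsto_const_nhds.inner hu) (by simp [hZX])
  have hwm : ‖w‖ ^ 2 = m := tendsto_nhds_unique (hw.norm.pow 2) (by simpa [hZs] using hsψ)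
  refine ⟨m, hmΛ, _, hlim, huX, hu1, ?_⟩
  have hEL : ∀ Y ∈ Γ, (∀ i, ⟪(X i).1, Y.1⟫ = 0) → ⟪w, Y.2.2⟫ = m * ⟪u, Y.1⟫ := by
    intro Y hY hYX
    -- First variation of ‖ℓ(u + tY)‖² - m‖u + tY‖², which is nonnegative and vanishes at t = 0.
    have h1 : 2 * (⟪w, Y.2.2⟫ - m * ⟪u, Y.1⟫) = 0 :=
      eq_zero_of_forall_quadratic_nonneg (c := ‖Y.2.2‖ ^ 2 - m * ‖Y.1‖ ^ 2) fun t => by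
        have h2 := hmin _ (Γ.add_mem hlim (Γ.smul_mem t hY)) fun i => by
          simp [inner_add_right, inner_smul_right, hYX, huX]
        simp only [Prod.fst_add, Prod.snd_add, Prod.smul_fst, Prod.smul_snd] at h2
        rw [norm_add_sq_real, norm_add_sq_real, norm_smul, norm_smul, inner_smul_right,
          inner_smul_right, hu1, hwm, mul_pow, mul_pow, Real.norm_eq_abs, sq_abs] at h2
        linarith
    linarith
  intro Y hY
  have h1 := hEL (Y - ∑ i, ⟪(X i).1, Y.1⟫ • X i)
    (Γ.sub_mem hY (Γ.sum_mem fun i _ => Γ.smul_mem _ (hX i))) fun i => by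
      have := orthonormal_iff_ite.1 hon
      simp [inner_sub_right, Prod.fst_sum, inner_sum, inner_smul_right, this]
  -- The projection removed from `Y` contributes to neither side, because each `X i` is an
  -- eigenvector orthogonal to `u`.
  have h2 : ∀ i, ⟪w, (X i).2.2⟫ = 0 := fun i => by
    have := heig i _ hlim
    simp only [huX, mul_zero] at this
    rwa [real_inner_comm]
  have h3 : ∀ i, ⟪u, (X i).1⟫ = 0 := fun i => by rw [real_inner_comm, huX]
  simp only [Prod.fst_sub, Prod.snd_sub, Prod.fst_sum, Prod.snd_sum, Prod.smul_fst, Prod.smul_snd,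
    inner_sub_right, inner_sum, inner_smul_right, h2, h3] at h1
  simpa using h1

end HypClamped

/-! ### Bounded domains are Euclidean-bounded and stay away from the boundary of the half-space. -/

namespace HypClamped

variable {n : ℕ} [NeZero n]

theorem abs_height_le (v : Coord n) : |height v| ≤ ‖v‖ := by
  simpa [height] using PiLp.norm_apply_le v (lastIdx n)

theorem hasDerivAt_height_comp {γ : ℝ → Coord n} (hγ : ContDiff ℝ 1 γ) (t : ℝ) :
    HasDerivAt (fun s => height (γ s)) (height (deriv γ t)) t := by
  have h1 : HasDerivAt γ (deriv γ t) t := ((hγ.differentiable (by simp)) t).hasDerivAt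
  exact (EuclideanSpace.proj (𝕜 := ℝ)
    (lastIdx n) : Coord n →L[ℝ] ℝ).hasFDerivAt.comp_hasDerivAt t h1

theorem sqrt_hypMetric_self {x : Coord n} (hx : 0 < height x) (v : Coord n) :
    √(hypMetric x v v) = ‖v‖ / height x := by
  rw [hypMetric, real_inner_self_eq_norm_sq, ← div_pow, Real.sqrt_sq (by positivity)]

/-- The derivative of log x_n along a curve is at most ‖γ'‖ / x_n, the hyperbolic speed, so log x_n
is 1-Lipschitz for arc length. -/
theorem enorm_log_height_sub_le {γ : ℝ → Coord n} (hγ : ContDiff ℝ 1 γ)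
    (hm : Set.MapsTo γ (Set.Icc 0 1) (halfSpace n)) {t : ℝ} (ht : t ∈ Set.Icc (0 : ℝ) 1) :
    ‖Real.log (height (γ t)) - Real.log (height (γ 0))‖ₑ ≤ hypLength γ := by
  have hsub : Set.Icc 0 t ⊆ Set.Icc (0 : ℝ) 1 := Set.Icc_subset_Icc_right ht.2
  have hpos : ∀ s ∈ Set.Icc (0 : ℝ) 1, 0 < height (γ s) := fun s hs => hm hs
  have hcd : ContDiffOn ℝ 1 (fun s => Real.log (height (γ s))) (Set.Icc 0 t) :=
    ContDiffOn.log (((contDiff_height.of_le (by simp)).comp hγ).contDiffOn)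
      fun s hs => (hpos s (hsub hs)).ne'
  refine (enorm_sub_le_lintegral_deriv_of_contDiffOn_Icc hcd ht.1).trans ?_
  refine (lintegral_mono_set hsub).trans ?_
  refine setLIntegral_mono' measurableSet_Icc fun s hs => ?_
  rw [((hasDerivAt_height_comp hγ s).log (hpos s hs).ne').deriv, sqrt_hypMetric_self (hpos s hs),
    ← ofReal_norm, norm_div, Real.norm_eq_abs, Real.norm_of_nonneg (hpos s hs).le]
  exact ENNReal.ofReal_le_ofReal (div_le_div_of_nonneg_right (abs_height_le _) (hpos s hs).le)

/-- The height changes by a factor of at most e^R along the curve, hence Euclidean speed is at most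
`height (γ 0) * exp R` times hyperbolic speed. -/
theorem bounds_of_hypLength_le {γ : ℝ → Coord n} (hγ : ContDiff ℝ 1 γ)
    (hm : Set.MapsTo γ (Set.Icc 0 1) (halfSpace n)) {R : ℝ} (hR : 0 ≤ R)
    (hL : hypLength γ ≤ ENNReal.ofReal R) :
    height (γ 0) * Real.exp (-R) ≤ height (γ 1) ∧ height (γ 1) ≤ height (γ 0) * Real.exp R ∧
      ‖γ 1 - γ 0‖ ≤ height (γ 0) * Real.exp R * R := by
  have hpos : ∀ s ∈ Set.Icc (0 : ℝ) 1, 0 < height (γ s) := fun s hs => hm hs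
  have h0 : 0 < height (γ 0) := hpos 0 (by simp)
  have hlog : ∀ t ∈ Set.Icc (0 : ℝ) 1,
      |Real.log (height (γ t)) - Real.log (height (γ 0))| ≤ R := fun t ht => by
    have := (enorm_log_height_sub_le hγ hm ht).trans hL
    rwa [← ofReal_norm, ENNReal.ofReal_le_ofReal_iff hR, Real.norm_eq_abs] at this
  have hup : ∀ t ∈ Set.Icc (0 : ℝ) 1, height (γ t) ≤ height (γ 0) * Real.exp R := fun t ht => by
    have := (abs_le.1 (hlog t ht)).2
    rw [← Real.log_le_log_iff (hpos t ht) (by positivity), Real.log_mul h0.ne' (by positivity),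
      Real.log_exp]
    linarith
  refine ⟨?_, hup 1 (by simp), ?_⟩
  · have := (abs_le.1 (hlog 1 (by simp))).1
    rw [← Real.log_le_log_iff (by positivity) (hpos 1 (by simp)),
      Real.log_mul h0.ne' (by positivity), Real.log_exp]
    linarith
  · have h1 := enorm_sub_le_lintegral_deriv_of_contDiffOn_Icc hγ.contDiffOn
      (zero_le_one (α := ℝ))
    have h2 : ∫⁻ t in Set.Icc (0 : ℝ) 1, ‖deriv γ t‖ₑ ≤
        ∫⁻ t in Set.Icc (0 : ℝ) 1, ENNReal.ofReal (height (γ 0) * Real.exp R) *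
          ENNReal.ofReal √(hypMetric (γ t) (deriv γ t) (deriv γ t)) := by
      refine setLIntegral_mono' measurableSet_Icc fun s hs => ?_
      rw [sqrt_hypMetric_self (hpos s hs), ← ENNReal.ofReal_mul (by positivity),
        ← ofReal_norm]
      refine ENNReal.ofReal_le_ofReal ?_
      rw [mul_div_assoc', le_div_iff₀ (hpos s hs), mul_comm]
      exact mul_le_mul_of_nonneg_right (hup s hs) (norm_nonneg _)
    rw [lintegral_const_mul' _ _ ENNReal.ofReal_ne_top] at h2
    have h3 := (h1.trans h2).trans (mul_le_mul_right hL _)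
    rw [← ENNReal.ofReal_mul (by positivity), ← ofReal_norm,
      ENNReal.ofReal_le_ofReal_iff (by positivity)] at h3
    exact h3

theorem BoundedDomain.exists_bounds (Ω : BoundedDomain n) :
    ∃ a b : ℝ, 0 < a ∧ ∀ x ∈ Ω.carrier, a ≤ height x ∧ ‖x‖ ≤ b := by
  obtain ⟨R, hR⟩ := Ω.bounded
  obtain ⟨x, hx⟩ := Ω.isConnected.nonempty
  have hxp : 0 < height x := Ω.subset_halfSpace hx
  -- The strict excess over `R` lets the infimum defining the distance be replaced by an actual
  -- curve; the maximum guards against negative `R`.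
  set S := max R 0 + 1 with hS
  have hS0 : 0 < S := by positivity
  refine ⟨height x * Real.exp (-S), ‖x‖ + height x * Real.exp S * S, by positivity,
    fun y hy => ?_⟩
  have h1 : hypEDist x y < ENNReal.ofReal S := (hR x hx y hy).trans_lt
    ((ENNReal.ofReal_lt_ofReal_iff hS0).2 (by rw [hS]; linarith [le_max_left R 0]))
  rw [hypEDist] at h1
  simp only [iInf_lt_iff] at h1
  obtain ⟨γ, ⟨hγ, hm, rfl, rfl⟩, hL⟩ := h1
  obtain ⟨h2, -, h4⟩ := bounds_of_hypLength_le hγ hm hS0.le hL.le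
  refine ⟨h2, ?_⟩
  have := norm_le_insert' (γ 1) (γ 0)
  linarith

end HypClamped

namespace HypClamped

noncomputable section

open scoped RealInnerProductSpace

variable {n : ℕ} [NeZero n] {Ω : BoundedDomain n}

/-! ### Calculus of test functions -/

theorem IsTest.eq_zero {φ : Coord n → ℝ} (hφ : IsTest Ω φ) {x : Coord n} (hx : x ∉ Ω.carrier) :
    φ x = 0 :=
  image_eq_zero_of_notMem_tsupport fun h => hx (hφ.supp h)

theorem IsTest.differentiableAt {φ : Coord n → ℝ} (hφ : IsTest Ω φ) (x : Coord n) :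
    DifferentiableAt ℝ φ x := (hφ.smooth.differentiable (by simp)) x

theorem IsTest.continuous {φ : Coord n → ℝ} (hφ : IsTest Ω φ) : Continuous φ :=
  hφ.smooth.continuous

theorem IsTest.integrable {φ : Coord n → ℝ} (hφ : IsTest Ω φ) : Integrable φ :=
  hφ.continuous.integrable_of_hasCompactSupport hφ.compact

theorem IsTest.mul {φ ψ : Coord n → ℝ} (hφ : IsTest Ω φ) (hψ : IsTest Ω ψ) : IsTest Ω (φ * ψ) :=
  hψ.smooth_mul hφ.smooth

/-- Off the support of `φ` the product vanishes locally, so the multiplier, a power or logarithm of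
x_n, need only be smooth inside `Ω`. -/
theorem IsTest.smoothOn_mul {φ ψ : Coord n → ℝ} (hψ : ∀ x ∈ Ω.carrier, ContDiffAt ℝ ∞ ψ x)
    (hφ : IsTest Ω φ) : IsTest Ω (ψ * φ) where
  smooth := by
    rw [contDiff_iff_contDiffAt]
    intro x
    by_cases hx : x ∈ tsupport φ
    · exact (hψ x (hφ.supp hx)).mul hφ.smooth.contDiffAt
    · have h0 : φ =ᶠ[𝓝 x] 0 := notMem_tsupport_iff_eventuallyEq.1 hx
      refine (contDiffAt_const (c := (0 : ℝ))).congr_of_eventuallyEq ?_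
      filter_upwards [h0] with y hy
      simp [hy]
  compact := hφ.compact.mul_left
  supp := (tsupport_mul_subset_right).trans hφ.supp

theorem height_pos (Ω : BoundedDomain n) {x : Coord n} (hx : x ∈ Ω.carrier) : 0 < height x :=
  Ω.subset_halfSpace hx

theorem IsTest.zpow_mul {φ : Coord n → ℝ} (hφ : IsTest Ω φ) (m : ℤ) :
    IsTest Ω ((fun x => height x ^ m) * φ) := by
  refine hφ.smoothOn_mul fun x hx => ?_
  have hne : height x ≠ 0 := (height_pos Ω hx).ne'
  cases m with
  | ofNat p =>
    simp only [Int.ofNat_eq_natCast, zpow_natCast]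
    exact (contDiff_height.pow p).contDiffAt
  | negSucc p =>
    simp only [zpow_negSucc]
    exact ((contDiff_height.pow (p + 1)).contDiffAt).inv (pow_ne_zero _ hne)

theorem IsTest.pow_mul {φ : Coord n → ℝ} (hφ : IsTest Ω φ) (m : ℕ) :
    IsTest Ω ((fun x => height x ^ m) * φ) :=
  hφ.smooth_mul (contDiff_height.pow m)

theorem IsTest.log_mul {φ : Coord n → ℝ} (hφ : IsTest Ω φ) :
    IsTest Ω ((fun x => Real.log (height x)) * φ) :=
  hφ.smoothOn_mul fun _ hx => contDiff_height.contDiffAt.log (height_pos Ω hx).ne'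

theorem hasFDerivAt_height (x : Coord n) : HasFDerivAt (height : Coord n → ℝ)
    (EuclideanSpace.proj (𝕜 := ℝ) (lastIdx n) : Coord n →L[ℝ] ℝ) x :=
  (EuclideanSpace.proj (𝕜 := ℝ) (lastIdx n) : Coord n →L[ℝ] ℝ).hasFDerivAt

theorem pd_comp_height {F : ℝ → ℝ} {F' : ℝ} {x : Coord n} (hF : HasDerivAt F F' (height x))
    (a : Fin n) : pd a (fun y => F (height y)) x = if a = lastIdx n then F' else 0 := by
  have h := (hF.comp_hasFDerivAt x (hasFDerivAt_height x)).fderiv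
  simp only [Function.comp_def] at h
  rw [pd, h]
  by_cases ha : a = lastIdx n
  · simp [ha]
  · simp [ha, Ne.symm ha]

theorem differentiableAt_comp_height {F : ℝ → ℝ} {F' : ℝ} {x : Coord n}
    (hF : HasDerivAt F F' (height x)) : DifferentiableAt ℝ (fun y => F (height y)) x :=
  (hF.comp_hasFDerivAt x (hasFDerivAt_height x)).differentiableAt

theorem pd_mul {n : ℕ} {a : Fin n} {φ ψ : Coord n → ℝ} {x : Coord n} (hφ : DifferentiableAt ℝ φ x)
    (hψ : DifferentiableAt ℝ ψ x) :
    pd a (φ * ψ) x = pd a φ x * ψ x + φ x * pd a ψ x := by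
  simp only [pd, fderiv_mul hφ hψ]
  simp
  ring

theorem integral_pd (a : Fin n) {φ : Coord n → ℝ} (hφ : IsTest Ω φ) : ∫ x, pd a φ x = 0 := by
  have := integral_mul_fderiv_eq_neg_fderiv_mul_of_integrable (μ := (volume : Measure (Coord n)))
    (f := fun _ => (1 : ℝ)) (g := φ) (v := EuclideanSpace.single a 1)
    (by simp) (by simp only [one_mul]; exact (hφ.pd a).integrable) (by simpa using hφ.integrable)
    (by simp) (fun x _ => hφ.differentiableAt x)
  simpa [pd] using this

theorem integral_pd_mul (a : Fin n) {φ ψ : Coord n → ℝ} (hφ : IsTest Ω φ) (hψ : IsTest Ω ψ) :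
    ∫ x, pd a φ x * ψ x = -∫ x, φ x * pd a ψ x := by
  have h := integral_pd a (hφ.mul hψ)
  simp only [pd_mul (hφ.differentiableAt _) (hψ.differentiableAt _)] at h
  have h1 : Integrable fun x => pd a φ x * ψ x := ((hφ.pd a).mul hψ).integrable
  have h2 : Integrable fun x => φ x * pd a ψ x := (hφ.mul (hψ.pd a)).integrable
  rw [integral_add h1 h2] at h
  linarith

/-! ### Integration by parts for the hyperbolic volume, the Hardy inequality and the commutators. -/

/-- For a function that vanishes off `Ω`, the Riemannian integral in coordinates. -/
theorem integral_vol {φ : Coord n → ℝ} (hφ : ∀ x ∉ Ω.carrier, φ x = 0) :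
    ∫ x, φ x ∂(vol Ω) = ∫ x, height x ^ (-(n : ℤ)) * φ x := by
  have hm : Measurable fun x : Coord n => ENNReal.ofReal ((height x ^ n)⁻¹) :=
    ((contDiff_height.continuous.measurable.pow_const n).inv).ennreal_ofReal
  rw [vol, restrict_withDensity Ω.isOpen.measurableSet,
    integral_withDensity_eq_integral_toReal_smul hm (by simp)]
  rw [← setIntegral_eq_integral_of_forall_compl_eq_zero (s := Ω.carrier)
    (f := fun x => height x ^ (-(n : ℤ)) * φ x) (fun x hx => by simp [hφ x hx])]
  refine setIntegral_congr_fun Ω.isOpen.measurableSet fun x hx => ?_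
  have := height_pos Ω hx
  simp only [smul_eq_mul]
  rw [ENNReal.toReal_ofReal (by positivity), zpow_neg, zpow_natCast]

theorem IsTest.integrable_vol {φ : Coord n → ℝ} (hφ : IsTest Ω φ) : Integrable φ (vol Ω) := by
  have hm : Measurable fun x : Coord n => ENNReal.ofReal ((height x ^ n)⁻¹) :=
    ((contDiff_height.continuous.measurable.pow_const n).inv).ennreal_ofReal
  rw [vol, restrict_withDensity Ω.isOpen.measurableSet,
    integrable_withDensity_iff_integrable_smul' hm (by simp)]
  refine (hφ.zpow_mul (-(n : ℤ))).integrable.integrableOn.congr_fun (fun x hx => ?_)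
    Ω.isOpen.measurableSet
  have := height_pos Ω hx
  simp only [smul_eq_mul, Pi.mul_apply]
  rw [ENNReal.toReal_ofReal (by positivity), zpow_neg, zpow_natCast]

/-- Integration by parts against powers of the height, for the Riemannian volume. -/
theorem integral_pow_mul_pd (q : ℕ) (a : Fin n) {φ : Coord n → ℝ} (hφ : IsTest Ω φ) :
    ∫ x, height x ^ (q + 1) * pd a φ x ∂(vol Ω) =
      if a = lastIdx n then ((n : ℝ) - (q + 1)) * ∫ x, height x ^ q * φ x ∂(vol Ω) else 0 := by
  set m : ℤ := (q : ℤ) + 1 - n with hm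
  rw [integral_vol (fun x hx => by rw [(hφ.pd a).eq_zero hx, mul_zero]),
    integral_vol (fun x hx => by rw [hφ.eq_zero hx, mul_zero])]
  have h0 := integral_pd a (hφ.zpow_mul m)
  -- With m = q + 1 - n, the density x_n⁻ⁿ and the factor x_n^(q+1) merge into x_n^m. The Lebesgue
  -- integral of ∂_a(x_n^m φ) is zero, and the product rule gives the two terms.
  have hpt : ∀ x, pd a ((fun x => height x ^ m) * φ) x =
      (if a = lastIdx n then (m : ℝ) else 0) * (height x ^ (-(n : ℤ)) * (height x ^ q * φ x)) +
        height x ^ (-(n : ℤ)) * (height x ^ (q + 1) * pd a φ x) := by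
    intro x
    by_cases hx : x ∈ Ω.carrier
    · have hne : height x ≠ 0 := (height_pos Ω hx).ne'
      have hd : HasDerivAt (fun s : ℝ => s ^ m) ((m : ℝ) * height x ^ (m - 1)) (height x) :=
        hasDerivAt_zpow m _ (Or.inl hne)
      rw [pd_mul (differentiableAt_comp_height hd)
        (hφ.differentiableAt x), pd_comp_height hd]
      have e1 : height x ^ (m - 1) = height x ^ (-(n : ℤ)) * height x ^ q := by
        rw [← zpow_natCast (height x) q, ← zpow_add₀ hne]
        congr 1
        omega
      have e2 : height x ^ m = height x ^ (-(n : ℤ)) * height x ^ (q + 1) := by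
        rw [← zpow_natCast (height x) (q + 1), ← zpow_add₀ hne]
        congr 1
        push_cast
        omega
      rw [e1, e2]
      split_ifs <;> ring
    · rw [((hφ.zpow_mul m).pd a).eq_zero hx, hφ.eq_zero hx, (hφ.pd a).eq_zero hx]
      ring
  simp only [hpt] at h0
  have i1 : Integrable fun x => height x ^ (-(n : ℤ)) * (height x ^ q * φ x) :=
    ((hφ.pow_mul q).zpow_mul _).integrable
  have i2 : Integrable fun x => height x ^ (-(n : ℤ)) * (height x ^ (q + 1) * pd a φ x) :=
    (((hφ.pd a).pow_mul (q + 1)).zpow_mul _).integrable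
  rw [integral_add (i1.const_mul _) i2, integral_const_mul] at h0
  split_ifs with ha
  · rw [if_pos ha] at h0
    have : (m : ℝ) = q + 1 - n := by rw [hm]; push_cast; ring
    rw [this] at h0
    linarith
  · rw [if_neg ha] at h0
    linarith

/-- The operator `[Δ, log x_n] = 2 x_n ∂_n + (1 - n)`. -/
def bop (φ : Coord n → ℝ) (x : Coord n) : ℝ :=
  2 * height x * pd (lastIdx n) φ x + (1 - (n : ℝ)) * φ x

theorem IsTest.bop {φ : Coord n → ℝ} (hφ : IsTest Ω φ) : IsTest Ω (bop φ) := by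
  have h : HypClamped.bop φ = (fun x => 2 * height x) * HypClamped.pd (lastIdx n) φ +
      (1 - (n : ℝ)) • φ := by
    funext x
    simp [HypClamped.bop]
  rw [h]
  exact (IsTest.smooth_mul (contDiff_const.mul contDiff_height) (hφ.pd _)).add (hφ.smul _)

/-- The two products add up to 2 x_n ∂_n(φψ) + 2(1 - n) φψ, and ∫ x_n ∂_n(φψ) dV = (n - 1) ∫ φψ dV.
The constant 1 - n in `bop` is what makes it skew. -/
theorem integral_bop_mul {φ ψ : Coord n → ℝ} (hφ : IsTest Ω φ) (hψ : IsTest Ω ψ) :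
    ∫ x, bop φ x * ψ x ∂(vol Ω) = -∫ x, φ x * bop ψ x ∂(vol Ω) := by
  have h := integral_pow_mul_pd 0 (lastIdx n) (hφ.mul hψ)
  rw [if_pos rfl] at h
  have i1 : Integrable (fun x => bop φ x * ψ x) (vol Ω) := (hφ.bop.mul hψ).integrable_vol
  have i2 : Integrable (fun x => φ x * bop ψ x) (vol Ω) := (hφ.mul hψ.bop).integrable_vol
  have i3 : Integrable (fun x => height x ^ (0 + 1) * pd (lastIdx n) (φ * ψ) x) (vol Ω) :=
    (((hφ.mul hψ).pd _).pow_mul 1).integrable_vol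
  have i4 : Integrable (fun x => height x ^ 0 * (φ * ψ) x) (vol Ω) :=
    ((hφ.mul hψ).pow_mul 0).integrable_vol
  have e : ∫ x, (bop φ x * ψ x + φ x * bop ψ x) ∂(vol Ω) =
      ∫ x, (2 * (height x ^ (0 + 1) * pd (lastIdx n) (φ * ψ) x) +
        2 * (1 - (n : ℝ)) * (height x ^ 0 * (φ * ψ) x)) ∂(vol Ω) := by
    congr 1
    funext x
    rw [pd_mul (hφ.differentiableAt x) (hψ.differentiableAt x), bop, bop, Pi.mul_apply]
    ring
  rw [integral_add i1 i2, integral_add (i3.const_mul _) (i4.const_mul _), integral_const_mul,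
    integral_const_mul, h] at e
  push_cast at e
  linarith

/-- Green's formula on `ℍⁿ`. -/
theorem integral_hypLap_mul {φ ψ : Coord n → ℝ} (hφ : IsTest Ω φ) (hψ : IsTest Ω ψ) :
    ∫ x, hypLap φ x * ψ x ∂(vol Ω) =
      -∑ j, ∫ x, height x ^ 2 * (pd j φ x * pd j ψ x) ∂(vol Ω) := by
  have hj : ∀ j, IsTest Ω (pd j φ * ψ) := fun j => (hφ.pd j).mul hψ
  have h := fun j => integral_pow_mul_pd 1 j (hj j)
  have i1 : ∀ j, Integrable (fun x => height x ^ (1 + 1) * pd j (pd j φ * ψ) x) (vol Ω) :=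
    fun j => (((hj j).pd j).pow_mul 2).integrable_vol
  have i2 : ∀ j, Integrable (fun x => height x ^ 2 * (pd j φ x * pd j ψ x)) (vol Ω) :=
    fun j => (((hφ.pd j).mul (hψ.pd j)).pow_mul 2).integrable_vol
  have i3 : Integrable (fun x => height x ^ 1 * (pd (lastIdx n) φ * ψ) x) (vol Ω) :=
    ((hj _).pow_mul 1).integrable_vol
  -- Integrating x_n² ∂_j(∂_jφ ψ) leaves (n - 2) x_n ∂_nφ ψ when j is the last index, which cancels
  -- the first-order term of Δ.
  have e : ∫ x, hypLap φ x * ψ x ∂(vol Ω) =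
      ∫ x, (∑ j, height x ^ (1 + 1) * pd j (pd j φ * ψ) x -
        ∑ j, height x ^ 2 * (pd j φ x * pd j ψ x) +
        (2 - (n : ℝ)) * (height x ^ 1 * (pd (lastIdx n) φ * ψ) x)) ∂(vol Ω) := by
    congr 1
    funext x
    simp only [pd_mul ((hφ.pd _).differentiableAt x) (hψ.differentiableAt x), hypLap, Pi.mul_apply]
    rw [← Finset.sum_sub_distrib, add_mul, mul_assoc, Finset.sum_mul, Finset.mul_sum]
    congr 1
    · exact Finset.sum_congr rfl fun j _ => by ring
    · ring
  have s1 : Integrable (fun x => ∑ j, height x ^ (1 + 1) * pd j (pd j φ * ψ) x) (vol Ω) :=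
    integrable_finsetSum _ fun j _ => i1 j
  have s2 : Integrable (fun x => ∑ j, height x ^ 2 * (pd j φ x * pd j ψ x)) (vol Ω) :=
    integrable_finsetSum _ fun j _ => i2 j
  have s12 : Integrable (fun x => ∑ j, height x ^ (1 + 1) * pd j (pd j φ * ψ) x -
      ∑ j, height x ^ 2 * (pd j φ x * pd j ψ x)) (vol Ω) := s1.sub s2
  rw [e, integral_add s12 (i3.const_mul _), integral_sub s1 s2,
    integral_finsetSum _ fun j _ => i1 j, integral_finsetSum _ fun j _ => i2 j, integral_const_mul]
  simp only [h]
  rw [Finset.sum_ite_eq' Finset.univ (lastIdx n)]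
  simp
  ring

theorem integral_hypLap_mul_comm {φ ψ : Coord n → ℝ} (hφ : IsTest Ω φ) (hψ : IsTest Ω ψ) :
    ∫ x, hypLap φ x * ψ x ∂(vol Ω) = ∫ x, φ x * hypLap ψ x ∂(vol Ω) := by
  have h : ∫ x, φ x * hypLap ψ x ∂(vol Ω) = ∫ x, hypLap ψ x * φ x ∂(vol Ω) := by
    simp only [mul_comm]
  rw [h, integral_hypLap_mul hφ hψ, integral_hypLap_mul hψ hφ]
  simp only [mul_comm]

/-- The Hardy type inequality `‖[Δ, log x_n]φ‖² + (n-1)²‖φ‖² ≤ 4 ‖∇φ‖²`. -/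
theorem integral_bop_sq_add_le {φ : Coord n → ℝ} (hφ : IsTest Ω φ) :
    ∫ x, bop φ x * bop φ x ∂(vol Ω) + ((n : ℝ) - 1) ^ 2 * ∫ x, φ x * φ x ∂(vol Ω) ≤
      -4 * ∫ x, hypLap φ x * φ x ∂(vol Ω) := by
  have h1 : ∫ x, bop φ x * φ x ∂(vol Ω) = 0 := by
    have := integral_bop_mul hφ hφ
    have e : ∫ x, φ x * bop φ x ∂(vol Ω) = ∫ x, bop φ x * φ x ∂(vol Ω) := by
      simp only [mul_comm]
    linarith
  have i1 : Integrable (fun x => bop φ x * bop φ x) (vol Ω) := (hφ.bop.mul hφ.bop).integrable_vol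
  have i2 : Integrable (fun x => φ x * φ x) (vol Ω) := (hφ.mul hφ).integrable_vol
  have i3 : Integrable (fun x => bop φ x * φ x) (vol Ω) := (hφ.bop.mul hφ).integrable_vol
  have i4 : ∀ j, Integrable (fun x => height x ^ 2 * (pd j φ x * pd j φ x)) (vol Ω) :=
    fun j => (((hφ.pd j).mul (hφ.pd j)).pow_mul 2).integrable_vol
  -- Square 2 x_n ∂_nφ = bφ + (n - 1)φ; the cross term is zero by skewness. The other partial
  -- derivatives are then discarded as nonnegative.
  have h2 : 4 * ∫ x, height x ^ 2 * (pd (lastIdx n) φ x * pd (lastIdx n) φ x) ∂(vol Ω) =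
      ∫ x, bop φ x * bop φ x ∂(vol Ω) + ((n : ℝ) - 1) ^ 2 * ∫ x, φ x * φ x ∂(vol Ω) +
        2 * ((n : ℝ) - 1) * ∫ x, bop φ x * φ x ∂(vol Ω) := by
    have i12 : Integrable (fun x => bop φ x * bop φ x + ((n : ℝ) - 1) ^ 2 * (φ x * φ x)) (vol Ω) :=
      i1.add (i2.const_mul _)
    rw [← integral_const_mul, ← integral_const_mul, ← integral_const_mul,
      ← integral_add i1 (i2.const_mul _), ← integral_add i12 (i3.const_mul _)]
    congr 1
    funext x
    simp only [bop]
    ring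
  rw [integral_hypLap_mul hφ hφ]
  have h3 : ∫ x, height x ^ 2 * (pd (lastIdx n) φ x * pd (lastIdx n) φ x) ∂(vol Ω) ≤
      ∑ j, ∫ x, height x ^ 2 * (pd j φ x * pd j φ x) ∂(vol Ω) :=
    Finset.single_le_sum (f := fun j => ∫ x, height x ^ 2 * (pd j φ x * pd j φ x) ∂(vol Ω))
      (fun j _ => integral_nonneg fun x => mul_nonneg (sq_nonneg _) (mul_self_nonneg _))
      (Finset.mem_univ _)
  rw [h1] at h2
  linarith

/-- `[Δ, log x_n] = bop`. -/
theorem hypLap_log_mul {φ : Coord n → ℝ} (hφ : IsTest Ω φ) :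
    hypLap ((fun x => Real.log (height x)) * φ) =
      (fun x => Real.log (height x)) * hypLap φ + bop φ := by
  have hL := hφ.log_mul
  have hlog : ∀ x ∈ Ω.carrier, HasDerivAt Real.log (height x)⁻¹ (height x) := fun x hx =>
    Real.hasDerivAt_log (height_pos Ω hx).ne'
  have hdl : ∀ x ∈ Ω.carrier, DifferentiableAt ℝ (fun x : Coord n => Real.log (height x)) x :=
    fun x hx => differentiableAt_comp_height (hlog x hx)
  have hpd : ∀ j, ∀ x ∈ Ω.carrier, pd j ((fun x => Real.log (height x)) * φ) x =
      (if j = lastIdx n then (height x)⁻¹ else 0) * φ x + Real.log (height x) * pd j φ x := by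
    intro j x hx
    rw [pd_mul (hdl x hx) (hφ.differentiableAt x), pd_comp_height (hlog x hx)]
  funext x
  by_cases hx : x ∈ Ω.carrier
  · have hne := (height_pos Ω hx).ne'
    have hpp : ∀ j, pd j (pd j ((fun x => Real.log (height x)) * φ)) x =
        (if j = lastIdx n then -(height x ^ 2)⁻¹ * φ x + 2 * (height x)⁻¹ * pd j φ x else 0) +
          Real.log (height x) * pd j (pd j φ) x := by
      intro j
      -- The product rule for the logarithm holds only on `Ω`, so the second derivative is computed
      -- from the germ at `x`.
      have hE : pd j ((fun x => Real.log (height x)) * φ) =ᶠ[𝓝 x]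
          (if j = lastIdx n then (fun y => (height y)⁻¹) * φ else 0) +
            (fun y => Real.log (height y)) * pd j φ := by
        filter_upwards [Ω.isOpen.mem_nhds hx] with y hy
        rw [hpd j y hy]
        split_ifs <;> simp
      have hi : HasDerivAt (fun s : ℝ => s⁻¹) (-(height x ^ 2)⁻¹) (height x) := hasDerivAt_inv hne
      have hdi : DifferentiableAt ℝ (fun y : Coord n => (height y)⁻¹) x :=
        differentiableAt_comp_height hi
      have h2 : DifferentiableAt ℝ ((fun y => Real.log (height y)) * pd j φ) x :=
        (hdl x hx).mul ((hφ.pd j).differentiableAt x)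
      have e2 : pd j ((fun y => Real.log (height y)) * pd j φ) x =
          (if j = lastIdx n then (height x)⁻¹ else 0) * pd j φ x +
            Real.log (height x) * pd j (pd j φ) x := by
        rw [pd_mul (hdl x hx) ((hφ.pd j).differentiableAt x), pd_comp_height (hlog x hx)]
      by_cases hj : j = lastIdx n
      · rw [if_pos hj] at hE e2 ⊢
        have h1 : DifferentiableAt ℝ ((fun y : Coord n => (height y)⁻¹) * φ) x :=
          hdi.mul (hφ.differentiableAt x)
        have e1 : pd j ((fun y : Coord n => (height y)⁻¹) * φ) x =
            -(height x ^ 2)⁻¹ * φ x + (height x)⁻¹ * pd j φ x := by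
          rw [pd_mul hdi (hφ.differentiableAt x), pd_comp_height hi, if_pos hj]
        have e3 : pd j (pd j ((fun x => Real.log (height x)) * φ)) x =
            pd j ((fun y : Coord n => (height y)⁻¹) * φ) x +
              pd j ((fun y => Real.log (height y)) * pd j φ) x := by
          simp only [pd] at h1 h2 hE ⊢
          rw [hE.fderiv_eq, fderiv_add h1 h2]
          rfl
        rw [e3, e1, e2]
        ring
      · rw [if_neg hj] at hE e2 ⊢
        have e3 : pd j (pd j ((fun x => Real.log (height x)) * φ)) x =
            pd j ((fun y => Real.log (height y)) * pd j φ) x := by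
          rw [zero_add] at hE
          simp only [pd] at hE ⊢
          rw [hE.fderiv_eq]
        rw [e3, e2]
        ring
    rw [Pi.add_apply, Pi.mul_apply, hypLap, hpd _ x hx, if_pos rfl]
    simp only [hpp]
    rw [Finset.sum_add_distrib, Finset.sum_ite_eq' Finset.univ (lastIdx n), ← Finset.mul_sum,
      if_pos (Finset.mem_univ _), hypLap, bop]
    field_simp
    ring
  · rw [hL.hypLap.eq_zero hx, Pi.add_apply, Pi.mul_apply, hφ.hypLap.eq_zero hx,
      hφ.bop.eq_zero hx]
    ring

/-- `[bop, log x_n] = 2`. -/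
theorem bop_log_mul {φ : Coord n → ℝ} (hφ : IsTest Ω φ) :
    bop ((fun x => Real.log (height x)) * φ) =
      (fun x => Real.log (height x)) * bop φ + (2 : ℝ) • φ := by
  funext x
  by_cases hx : x ∈ Ω.carrier
  · have hne := (height_pos Ω hx).ne'
    have hlog : HasDerivAt Real.log (height x)⁻¹ (height x) := Real.hasDerivAt_log hne
    rw [bop, pd_mul (differentiableAt_comp_height hlog)
      (hφ.differentiableAt x), pd_comp_height hlog, if_pos rfl]
    simp only [Pi.add_apply, Pi.mul_apply, Pi.smul_apply, smul_eq_mul, bop]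
    field_simp
    ring
  · rw [hφ.log_mul.bop.eq_zero hx, Pi.add_apply, Pi.mul_apply, hφ.bop.eq_zero hx,
      Pi.smul_apply, hφ.eq_zero hx]
    simp

end

end HypClamped

namespace HypClamped

noncomputable section

/-! ### Poincaré and Rellich type estimates in Euclidean space -/

theorem enorm_sq_eq_ofReal (r : ℝ) : ‖r‖ₑ ^ 2 = ENNReal.ofReal (r ^ 2) := by
  rw [← ofReal_norm, ← ENNReal.ofReal_pow (norm_nonneg _), Real.norm_eq_abs, sq_abs]

theorem lintegral_enorm_sq_le {α : Type*} [MeasurableSpace α] {μ : Measure α}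
    [IsProbabilityMeasure μ] {f : α → ℝ} (hf : AEStronglyMeasurable f μ) :
    (∫⁻ a, ‖f a‖ₑ ∂μ) ^ 2 ≤ ∫⁻ a, ‖f a‖ₑ ^ 2 ∂μ := by
  have h1 := eLpNorm_le_eLpNorm_of_exponent_le (p := 1) (q := 2) (by norm_num) hf
  have h2 := eLpNorm_nnreal_pow_eq_lintegral (f := f) (μ := μ) (p := 2) (by norm_num)
  rw [eLpNorm_one_eq_lintegral_enorm] at h1
  simp only [NNReal.coe_ofNat, ENNReal.coe_ofNat, ENNReal.rpow_ofNat] at h2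
  rw [← h2]
  exact pow_le_pow_left' h1 2

/-- Only this direction is needed when passing to Lebesgue integrals, and it requires no
integrability: in the other case the Bochner integral is 0 by convention. -/
theorem ofReal_integral_le_lintegral_ofReal {α : Type*} [MeasurableSpace α] {μ : Measure α}
    {f : α → ℝ} (hf : ∀ a, 0 ≤ f a) :
    ENNReal.ofReal (∫ a, f a ∂μ) ≤ ∫⁻ a, ENNReal.ofReal (f a) ∂μ := by
  by_cases h : Integrable f μ
  · exact (ofReal_integral_eq_lintegral_ofReal h (Eventually.of_forall hf)).le
  · simp [integral_undef h]

variable {n : ℕ}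

/-- The Dirichlet energy `∑ ∫ (∂φ/∂x_j)²`. -/
def energy (φ : Coord n → ℝ) : ℝ := ∑ j, ∫ x, pd j φ x ^ 2

theorem energy_nonneg (φ : Coord n → ℝ) : 0 ≤ energy φ :=
  Finset.sum_nonneg fun _ _ => integral_nonneg fun _ => sq_nonneg _

theorem fderiv_apply_sq_le (φ : Coord n → ℝ) (x z : Coord n) :
    fderiv ℝ φ x z ^ 2 ≤ ‖z‖ ^ 2 * ∑ j, pd j φ x ^ 2 := by
  have h : fderiv ℝ φ x z = ∑ j, z j * pd j φ x := by
    have hz : z = ∑ j, z j • EuclideanSpace.single j (1 : ℝ) := by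
      simpa using ((EuclideanSpace.basisFun (Fin n) ℝ).sum_repr z).symm
    conv_lhs => rw [hz]
    simp [map_sum, pd]
  rw [h, EuclideanSpace.real_norm_sq_eq]
  exact Finset.sum_mul_sq_le_sq_mul_sq _ _ _

variable {φ : Coord n → ℝ}

theorem continuous_pd (hφ : ContDiff ℝ 1 φ) (j : Fin n) : Continuous (pd j φ) :=
  (hφ.continuous_fderiv (by simp)).clm_apply continuous_const

theorem integrable_sq_of_compactSupport {f : Coord n → ℝ} (hf : Continuous f)
    (hc : HasCompactSupport f) : Integrable fun x => f x ^ 2 := by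
  simp only [sq]
  exact (hf.mul hf).integrable_of_hasCompactSupport hc.mul_left

theorem integrable_pd_sq (hφ : ContDiff ℝ 1 φ) (hc : HasCompactSupport φ) (j : Fin n) :
    Integrable fun x => pd j φ x ^ 2 :=
  integrable_sq_of_compactSupport (continuous_pd hφ j) (hc.fderiv_apply ℝ _)

/-- Write the increment as the integral of ∂_zφ over the segment, apply Cauchy–Schwarz on [0, 1],
exchange the integrals, and use translation invariance. -/
theorem lintegral_translate_sub_sq_le (hφ : ContDiff ℝ 1 φ) (hc : HasCompactSupport φ)
    (z : Coord n) :
    ∫⁻ x, ‖φ (x + z) - φ x‖ₑ ^ 2 ≤ ENNReal.ofReal (‖z‖ ^ 2 * energy φ) := by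
  have hprob : IsProbabilityMeasure ((volume : Measure ℝ).restrict (Set.Icc 0 1)) := ⟨by simp⟩
  have hcont : Continuous fun p : Coord n × ℝ => fderiv ℝ φ (p.1 + p.2 • z) z :=
    ((hφ.continuous_fderiv (by simp)).comp
      (continuous_fst.add (continuous_snd.smul continuous_const))).clm_apply continuous_const
  have hpt : ∀ x, ‖φ (x + z) - φ x‖ₑ ^ 2 ≤
      ∫⁻ t in Set.Icc (0 : ℝ) 1, ‖fderiv ℝ φ (x + t • z) z‖ₑ ^ 2 := by
    intro x
    have hl : ∀ t : ℝ, HasDerivAt (fun s : ℝ => φ (x + s • z)) (fderiv ℝ φ (x + t • z) z) t := by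
      intro t
      have h1 : HasDerivAt (fun s : ℝ => x + s • z) z t := by
        simpa using ((hasDerivAt_id t).smul_const z).const_add x
      exact ((hφ.differentiable (by simp)) (x + t • z)).hasFDerivAt.comp_hasDerivAt t h1
    have hcd : ContDiff ℝ 1 fun s : ℝ => φ (x + s • z) :=
      hφ.comp (contDiff_const.add (contDiff_id.smul contDiff_const))
    have h1 := enorm_sub_le_lintegral_deriv_of_contDiffOn_Icc (a := 0) (b := 1) hcd.contDiffOn
      zero_le_one
    simp only [one_smul, zero_smul, add_zero, fun t => (hl t).deriv] at h1
    refine (pow_le_pow_left' h1 2).trans (lintegral_enorm_sq_le ?_)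
    exact (hcont.comp (Continuous.prodMk_right x)).aestronglyMeasurable
  refine (lintegral_mono hpt).trans ?_
  rw [lintegral_lintegral_swap (by fun_prop)]
  have hin : ∀ t : ℝ, ∫⁻ x, ‖fderiv ℝ φ (x + t • z) z‖ₑ ^ 2 =
      ∫⁻ x, ‖fderiv ℝ φ x z‖ₑ ^ 2 := fun t =>
    lintegral_add_right_eq_self (fun x => ‖fderiv ℝ φ x z‖ₑ ^ 2) (t • z)
  simp only [hin]
  rw [lintegral_const, Measure.restrict_apply_univ, Real.volume_Icc, sub_zero, ENNReal.ofReal_one,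
    mul_one]
  have hint : Integrable fun x => ‖z‖ ^ 2 * ∑ j, pd j φ x ^ 2 :=
    (integrable_finsetSum _ fun j _ => integrable_pd_sq hφ hc j).const_mul _
  have hE : ‖z‖ ^ 2 * energy φ = ∫ x, ‖z‖ ^ 2 * ∑ j, pd j φ x ^ 2 := by
    rw [integral_const_mul, integral_finsetSum _ fun j _ => integrable_pd_sq hφ hc j, energy]
  rw [hE, ofReal_integral_eq_lintegral_ofReal hint (Eventually.of_forall fun x =>
    mul_nonneg (sq_nonneg _) (Finset.sum_nonneg fun _ _ => sq_nonneg _))]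
  refine lintegral_mono fun x => ?_
  rw [enorm_sq_eq_ofReal]
  exact ENNReal.ofReal_le_ofReal (fderiv_apply_sq_le φ x z)

theorem lintegral_enorm_sq_eq (hφ : Continuous φ) (hc : HasCompactSupport φ) :
    ∫⁻ x, ‖φ x‖ₑ ^ 2 = ENNReal.ofReal (∫ x, φ x ^ 2) := by
  rw [ofReal_integral_eq_lintegral_ofReal (integrable_sq_of_compactSupport hφ hc)
    (Eventually.of_forall fun x => sq_nonneg _)]
  simp only [enorm_sq_eq_ofReal]

/-- Poincaré's inequality for functions supported in a ball. -/
theorem integral_sq_le_energy [NeZero n] (hφ : ContDiff ℝ 1 φ) (hc : HasCompactSupport φ) {R : ℝ}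
    (hR : 0 ≤ R) (hs : ∀ x, φ x ≠ 0 → ‖x‖ ≤ R) :
    ∫ x, φ x ^ 2 ≤ (2 * R + 1) ^ 2 * energy φ := by
  -- A translation longer than the diameter 2R moves the support off itself, so φ(x + z) - φ(x) =
  -- -φ(x) wherever φ(x) ≠ 0.
  set z : Coord n := (2 * R + 1) • EuclideanSpace.single 0 (1 : ℝ) with hz
  have hzn : ‖z‖ = 2 * R + 1 := by
    rw [hz, norm_smul, PiLp.norm_single, norm_one, mul_one, Real.norm_of_nonneg]
    positivity
  have h := lintegral_translate_sub_sq_le hφ hc z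
  rw [hzn] at h
  have h2 : ∫⁻ x, ‖φ x‖ₑ ^ 2 ≤ ∫⁻ x, ‖φ (x + z) - φ x‖ₑ ^ 2 := by
    refine lintegral_mono fun x => ?_
    by_cases hx : φ x = 0
    · simp [hx]
    · have hxz : φ (x + z) = 0 := by
        by_contra h0
        have h1 := hs _ h0
        have h2 := hs _ hx
        have h3 : ‖z‖ ≤ ‖x + z‖ + ‖x‖ := by
          simpa using norm_sub_le (x + z) x
        linarith
      simp [hxz]
  have h3 := h2.trans h
  rw [lintegral_enorm_sq_eq hφ.continuous hc, ENNReal.ofReal_le_ofReal_iff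
    (mul_nonneg (sq_nonneg _) (energy_nonneg _))] at h3
  exact h3

/-! ### Averages over the cells of a grid. -/

/-- The cell with index `k` of the grid of mesh `δ`. -/
def cell (δ : ℝ) (k : Fin n → ℤ) : Set (Coord n) := {x | ∀ i, ⌊x i / δ⌋ = k i}

theorem cell_eq_preimage {δ : ℝ} (hδ : 0 < δ) (k : Fin n → ℤ) :
    cell δ k = (MeasurableEquiv.toLp 2 (Fin n → ℝ)).symm ⁻¹'
      Set.univ.pi fun i => Set.Ico (k i * δ) ((k i + 1) * δ) := by
  ext x
  simp [cell, Int.floor_eq_iff, le_div_iff₀ hδ, div_lt_iff₀ hδ]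

theorem measurableSet_cell {δ : ℝ} (hδ : 0 < δ) (k : Fin n → ℤ) :
    MeasurableSet (cell δ k) := by
  rw [cell_eq_preimage hδ]
  exact (MeasurableEquiv.measurable _) (MeasurableSet.univ_pi fun _ => measurableSet_Ico)

theorem volume_cell {δ : ℝ} (hδ : 0 < δ) (k : Fin n → ℤ) :
    volume (cell δ k) = ENNReal.ofReal (δ ^ n) := by
  rw [cell_eq_preimage hδ, (EuclideanSpace.volume_preserving_symm_measurableEquiv_toLp
    (Fin n)).measure_preimage_equiv, Real.volume_pi_Ico]
  have : ∀ i, ((k i : ℝ) + 1) * δ - k i * δ = δ := fun i => by ring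
  simp only [this]
  rw [Finset.prod_const, Finset.card_univ, Fintype.card_fin, ENNReal.ofReal_pow hδ.le]

theorem pairwise_disjoint_cell (δ : ℝ) :
    Pairwise (Function.onFun Disjoint (cell δ : (Fin n → ℤ) → Set (Coord n))) := by
  intro k l hkl
  rw [Function.onFun, Set.disjoint_left]
  intro x hx hy
  exact hkl (funext fun i => (hx i).symm.trans (hy i))

/-- The cube of vectors with coordinates at most `δ`. -/
def cube (n : ℕ) (δ : ℝ) : Set (Coord n) := {z | ∀ i, |z i| ≤ δ}

theorem cube_eq_preimage (δ : ℝ) :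
    cube n δ = (MeasurableEquiv.toLp 2 (Fin n → ℝ)).symm ⁻¹'
      Set.univ.pi fun _ => Set.Icc (-δ) δ := by
  ext x
  simp [cube, abs_le, -Set.pi_univ_Icc]

theorem measurableSet_cube (δ : ℝ) : MeasurableSet (cube n δ) := by
  rw [cube_eq_preimage]
  exact (MeasurableEquiv.measurable _) (MeasurableSet.univ_pi fun _ => measurableSet_Icc)

theorem volume_cube {δ : ℝ} (hδ : 0 < δ) :
    volume (cube n δ) = ENNReal.ofReal ((2 * δ) ^ n) := by
  rw [cube_eq_preimage, (EuclideanSpace.volume_preserving_symm_measurableEquiv_toLp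
    (Fin n)).measure_preimage_equiv, volume_pi_pi]
  have : δ - -δ = 2 * δ := by ring
  simp only [Real.volume_Icc, this]
  rw [Finset.prod_const, Finset.card_univ, Fintype.card_fin, ENNReal.ofReal_pow (by positivity)]

theorem sub_mem_cube {δ : ℝ} (hδ : 0 < δ) {k : Fin n → ℤ} {x y : Coord n} (hx : x ∈ cell δ k)
    (hy : y ∈ cell δ k) : y - x ∈ cube n δ := by
  intro i
  have h := Int.abs_sub_lt_one_of_floor_eq_floor ((hy i).trans (hx i).symm)
  rw [← sub_div, abs_div, abs_of_pos hδ, div_lt_one hδ] at h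
  exact h.le

theorem norm_sq_le_of_mem_cube {δ : ℝ} {z : Coord n} (hz : z ∈ cube n δ) :
    ‖z‖ ^ 2 ≤ n * δ ^ 2 := by
  rw [EuclideanSpace.real_norm_sq_eq]
  calc ∑ i, z i ^ 2 ≤ ∑ _i : Fin n, δ ^ 2 :=
        Finset.sum_le_sum fun i _ => sq_le_sq' (abs_le.1 (hz i)).1 (abs_le.1 (hz i)).2
    _ = n * δ ^ 2 := by simp

/-- The double integral over a set is, up to a factor, the variance. -/
theorem setIntegral_setIntegral_sub_sq {s : Set (Coord n)}
    (hs : volume s ≠ ⊤) {f : Coord n → ℝ} (hf : Integrable f) (hf2 : Integrable fun x => f x ^ 2) :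
    ∫ x in s, ∫ y in s, (f y - f x) ^ 2 =
      2 * (volume.real s * ∫ x in s, f x ^ 2) - 2 * (∫ x in s, f x) ^ 2 := by
  have : IsFiniteMeasure ((volume : Measure (Coord n)).restrict s) := ⟨by simpa using hs.lt_top⟩
  have i1 : Integrable f (volume.restrict s) := hf.restrict
  have i2 : Integrable (fun x => f x ^ 2) (volume.restrict s) := hf2.restrict
  set I := ∫ x in s, f x
  set J := ∫ x in s, f x ^ 2
  have h1 : ∀ x, ∫ y in s, (f y - f x) ^ 2 = J - 2 * I * f x + volume.real s * f x ^ 2 := by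
    intro x
    have e : ∀ y, (f y - f x) ^ 2 = f y ^ 2 - 2 * f x * f y + f x ^ 2 := fun y => by ring
    have i3 : Integrable (fun y => f y ^ 2 - 2 * f x * f y) (volume.restrict s) :=
      i2.sub (i1.const_mul _)
    simp only [e]
    rw [integral_add i3 (integrable_const _), integral_sub i2 (i1.const_mul _), integral_const_mul,
      integral_const, measureReal_restrict_apply_univ, smul_eq_mul]
    ring
  simp only [h1]
  have i4 : Integrable (fun x => J - 2 * I * f x) (volume.restrict s) :=
    (integrable_const _).sub (i1.const_mul _)
  rw [integral_add i4 (i2.const_mul _), integral_sub (integrable_const _) (i1.const_mul _),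
    integral_const_mul, integral_const_mul, integral_const, measureReal_restrict_apply_univ,
    smul_eq_mul]
  ring

/-- Two points of one cell differ by a vector of `cube n δ`. Since the cells are disjoint, the sum
is dominated by one integral over all translations in the cube, where the translation estimate
applies. -/
theorem sum_setLIntegral_cell_le {δ : ℝ} (hδ : 0 < δ) (hφ : ContDiff ℝ 1 φ)
    (hc : HasCompactSupport φ) (K : Finset (Fin n → ℤ)) :
    ∑ k ∈ K, ∫⁻ x in cell δ k, ∫⁻ y in cell δ k, ‖φ y - φ x‖ₑ ^ 2 ≤
      ENNReal.ofReal ((2 * δ) ^ n * (n * δ ^ 2 * energy φ)) := by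
  have hm : Measurable fun p : Coord n × Coord n => ‖φ (p.1 + p.2) - φ p.1‖ₑ ^ 2 := by
    have := hφ.continuous
    fun_prop
  have h1 : ∀ k, ∀ x ∈ cell δ k, ∫⁻ y in cell δ k, ‖φ y - φ x‖ₑ ^ 2 ≤
      ∫⁻ z in cube n δ, ‖φ (x + z) - φ x‖ₑ ^ 2 := by
    intro k x hx
    rw [← lintegral_indicator (measurableSet_cell hδ k),
      ← lintegral_indicator (measurableSet_cube δ),
      ← lintegral_add_left_eq_self _ x]
    refine lintegral_mono fun z => ?_
    by_cases hz : x + z ∈ cell δ k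
    · have : z ∈ cube n δ := by simpa using sub_mem_cube hδ hx hz
      rw [Set.indicator_of_mem hz, Set.indicator_of_mem this]
    · rw [Set.indicator_of_notMem hz]
      exact zero_le
  calc ∑ k ∈ K, ∫⁻ x in cell δ k, ∫⁻ y in cell δ k, ‖φ y - φ x‖ₑ ^ 2
      ≤ ∑ k ∈ K, ∫⁻ x in cell δ k, ∫⁻ z in cube n δ, ‖φ (x + z) - φ x‖ₑ ^ 2 :=
        Finset.sum_le_sum fun k _ => setLIntegral_mono' (measurableSet_cell hδ k) (h1 k)
    _ = ∫⁻ x in ⋃ k ∈ K, cell δ k, ∫⁻ z in cube n δ, ‖φ (x + z) - φ x‖ₑ ^ 2 :=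
        (lintegral_biUnion_finset ((pairwise_disjoint_cell δ).set_pairwise _)
          (fun k _ => measurableSet_cell hδ k) _).symm
    _ ≤ ∫⁻ x, ∫⁻ z in cube n δ, ‖φ (x + z) - φ x‖ₑ ^ 2 := setLIntegral_le_lintegral _ _
    _ = ∫⁻ z in cube n δ, ∫⁻ x, ‖φ (x + z) - φ x‖ₑ ^ 2 := lintegral_lintegral_swap hm.aemeasurable
    _ ≤ ∫⁻ _z in cube n δ, ENNReal.ofReal (n * δ ^ 2 * energy φ) := by
        refine setLIntegral_mono' (measurableSet_cube δ) fun z hz => ?_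
        exact (lintegral_translate_sub_sq_le hφ hc z).trans (ENNReal.ofReal_le_ofReal
          (mul_le_mul_of_nonneg_right (norm_sq_le_of_mem_cube hz) (energy_nonneg φ)))
    _ = ENNReal.ofReal ((2 * δ) ^ n * (n * δ ^ 2 * energy φ)) := by
        rw [setLIntegral_const, volume_cube hδ, ← ENNReal.ofReal_mul
          (mul_nonneg (by positivity) (energy_nonneg φ)), mul_comm]

/-- The finite-rank approximation of `L²` by averages over cells. -/
theorem integral_sq_le_sum_cell_add {δ : ℝ} (hδ : 0 < δ) (hφ : ContDiff ℝ 1 φ)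
    (hc : HasCompactSupport φ) {K : Finset (Fin n → ℤ)}
    (hK : ∀ x, φ x ≠ 0 → ∃ k ∈ K, x ∈ cell δ k) :
    ∫ x, φ x ^ 2 ≤ (δ ^ n)⁻¹ * ∑ k ∈ K, (∫ x in cell δ k, φ x) ^ 2 +
      2 ^ n * (n * δ ^ 2 * energy φ) := by
  have hint : Integrable φ := hφ.continuous.integrable_of_hasCompactSupport hc
  have hint2 := integrable_sq_of_compactSupport hφ.continuous hc
  have hfin : ∀ k : Fin n → ℤ, volume (cell δ k) ≠ ⊤ := fun k => by
    rw [volume_cell hδ]; exact ENNReal.ofReal_ne_top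
  have hreal : ∀ k : Fin n → ℤ, volume.real (cell δ k) = δ ^ n := fun k => by
    rw [measureReal_def, volume_cell hδ, ENNReal.toReal_ofReal (by positivity)]
  have hsum : ∫ x, φ x ^ 2 = ∑ k ∈ K, ∫ x in cell δ k, φ x ^ 2 := by
    rw [← integral_biUnion_finset K (fun k _ => measurableSet_cell hδ k)
      ((pairwise_disjoint_cell δ).set_pairwise _) fun k _ => hint2.integrableOn]
    refine (setIntegral_eq_integral_of_forall_compl_eq_zero fun x hx => ?_).symm
    by_contra h0
    obtain ⟨k, hk, hxk⟩ := hK x fun h => h0 (by rw [h]; norm_num)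
    exact hx (Set.mem_biUnion hk hxk)
  have hconv : ∀ k, ENNReal.ofReal (∫ x in cell δ k, ∫ y in cell δ k, (φ y - φ x) ^ 2) ≤
      ∫⁻ x in cell δ k, ∫⁻ y in cell δ k, ‖φ y - φ x‖ₑ ^ 2 := fun k => by
    have h1 : ∀ x, ENNReal.ofReal (∫ y in cell δ k, (φ y - φ x) ^ 2) ≤
        ∫⁻ y in cell δ k, ‖φ y - φ x‖ₑ ^ 2 := fun x => by
      simp only [enorm_sq_eq_ofReal]
      exact ofReal_integral_le_lintegral_ofReal fun y => sq_nonneg _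
    exact (ofReal_integral_le_lintegral_ofReal fun x => integral_nonneg fun y => sq_nonneg _).trans
      (lintegral_mono h1)
  have hD : ∑ k ∈ K, ∫ x in cell δ k, ∫ y in cell δ k, (φ y - φ x) ^ 2 ≤
      (2 * δ) ^ n * (n * δ ^ 2 * energy φ) := by
    have hpos : ∀ k, 0 ≤ ∫ x in cell δ k, ∫ y in cell δ k, (φ y - φ x) ^ 2 := fun k =>
      integral_nonneg fun x => integral_nonneg fun y => sq_nonneg _
    have := (Finset.sum_le_sum fun k (_ : k ∈ K) => hconv k).trans
      (sum_setLIntegral_cell_le hδ hφ hc K)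
    rwa [← ENNReal.ofReal_sum_of_nonneg fun k _ => hpos k, ENNReal.ofReal_le_ofReal_iff
      (mul_nonneg (by positivity) (mul_nonneg (by positivity) (energy_nonneg φ)))] at this
  simp only [setIntegral_setIntegral_sub_sq (hfin _) hint hint2, hreal,
    Finset.sum_sub_distrib, ← Finset.mul_sum] at hD
  rw [← hsum] at hD
  have hδn : 0 < δ ^ n := by positivity
  rw [mul_pow] at hD
  -- The variance identity would even allow half of the energy term; the factor is given away.
  have h2 : δ ^ n * ∫ x, φ x ^ 2 ≤ δ ^ n * ((δ ^ n)⁻¹ * ∑ k ∈ K, (∫ x in cell δ k, φ x) ^ 2 +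
      2 ^ n * (n * δ ^ 2 * energy φ)) := by
    rw [mul_add, mul_inv_cancel_left₀ hδn.ne']
    have : 0 ≤ 2 ^ n * δ ^ n * (n * δ ^ 2 * energy φ) :=
      mul_nonneg (by positivity) (mul_nonneg (by positivity) (energy_nonneg φ))
    linarith
  exact le_of_mul_le_mul_left h2 hδn

end

end HypClamped

namespace HypClamped

noncomputable section

open scoped RealInnerProductSpace

variable {n : ℕ} [NeZero n] {Ω : BoundedDomain n}

/-! ### Estimates for test functions -/

/-- The class of a test function in `L²(Ω)`. -/
def IsTest.toLp {φ : Coord n → ℝ} (hφ : IsTest Ω φ) : Lp ℝ 2 (vol Ω) := hφ.memLp.toLp φ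

theorem IsTest.coeFn_toLp {φ : Coord n → ℝ} (hφ : IsTest Ω φ) : hφ.toLp =ᵐ[vol Ω] φ :=
  hφ.memLp.coeFn_toLp

theorem inner_eq_integral_mul (u v : Lp ℝ 2 (vol Ω)) : ⟪u, v⟫ = ∫ x, u x * v x ∂(vol Ω) := by
  rw [L2.inner_def]
  refine integral_congr_ae (Eventually.of_forall fun x => ?_)
  simp [mul_comm]

theorem inner_toLp (u : Lp ℝ 2 (vol Ω)) {φ : Coord n → ℝ} (hφ : IsTest Ω φ) :
    ⟪u, hφ.toLp⟫ = ∫ x, u x * φ x ∂(vol Ω) := by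
  rw [inner_eq_integral_mul]
  refine integral_congr_ae ?_
  filter_upwards [hφ.coeFn_toLp] with x hx
  rw [hx]

theorem inner_toLp_toLp {φ ψ : Coord n → ℝ} (hφ : IsTest Ω φ) (hψ : IsTest Ω ψ) :
    ⟪hφ.toLp, hψ.toLp⟫ = ∫ x, φ x * ψ x ∂(vol Ω) := by
  rw [inner_toLp]
  refine integral_congr_ae ?_
  filter_upwards [hφ.coeFn_toLp] with x hx
  rw [hx]

theorem norm_toLp_sq {φ : Coord n → ℝ} (hφ : IsTest Ω φ) :
    ‖hφ.toLp‖ ^ 2 = ∫ x, φ x ^ 2 ∂(vol Ω) := by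
  rw [← real_inner_self_eq_norm_sq, inner_toLp_toLp]
  simp only [sq]

theorem IsTest.sq {φ : Coord n → ℝ} (hφ : IsTest Ω φ) : IsTest Ω fun x => φ x ^ 2 := by
  have : (fun x => φ x ^ 2) = φ * φ := by
    funext x
    simp [pow_two]
  rw [this]
  exact hφ.mul hφ

/-- On a bounded domain the Riemannian and the Lebesgue integrals are comparable, and the
height is bounded above and below. -/
theorem BoundedDomain.exists_comparison (Ω : BoundedDomain n) : ∃ a b C : ℝ, 0 < a ∧ 0 < b ∧ 0 < C ∧
    (∀ x ∈ Ω.carrier, a ≤ height x ∧ height x ≤ b ∧ ‖x‖ ≤ b) ∧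
    (∀ φ : Coord n → ℝ, IsTest Ω φ → (∀ x, 0 ≤ φ x) →
      ∫ x, φ x ≤ C * ∫ x, φ x ∂(vol Ω) ∧ ∫ x, φ x ∂(vol Ω) ≤ C * ∫ x, φ x) := by
  obtain ⟨a, b, ha, hab⟩ := Ω.exists_bounds
  have hb' : ∀ x ∈ Ω.carrier, a ≤ height x ∧ height x ≤ b ∧ ‖x‖ ≤ b := fun x hx =>
    ⟨(hab x hx).1, ((le_abs_self _).trans (abs_height_le x)).trans (hab x hx).2, (hab x hx).2⟩
  have hb : 0 < b := by
    obtain ⟨x, hx⟩ := Ω.isConnected.nonempty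
    exact (height_pos Ω hx).trans_le (hb' x hx).2.1
  -- The density lies between b⁻ⁿ and a⁻ⁿ; the sum serves as a constant for both directions.
  refine ⟨a, b, b ^ n + (a ^ n)⁻¹, ha, hb, by positivity, hb', fun φ hφ h0 => ?_⟩
  have hi : Integrable fun x => height x ^ (-(n : ℤ)) * φ x := (hφ.zpow_mul _).integrable
  rw [integral_vol fun x hx => hφ.eq_zero hx, ← integral_const_mul, ← integral_const_mul]
  constructor
  · refine integral_mono hφ.integrable (hi.const_mul _) fun x => ?_
    by_cases hx : x ∈ Ω.carrier
    · have hp := height_pos Ω hx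
      have h1 : height x ^ n ≤ b ^ n := pow_le_pow_left₀ hp.le (hb' x hx).2.1 n
      have h2 : 1 ≤ (b ^ n + (a ^ n)⁻¹) * (height x ^ n)⁻¹ := by
        rw [← div_eq_mul_inv, one_le_div (by positivity)]
        have : 0 < (a ^ n)⁻¹ := by positivity
        linarith
      simp only [zpow_neg, zpow_natCast]
      rw [← mul_assoc]
      exact le_mul_of_one_le_left (h0 x) h2
    · simp [hφ.eq_zero hx]
  · refine integral_mono hi (hφ.integrable.const_mul _) fun x => ?_
    by_cases hx : x ∈ Ω.carrier
    · have h1 : (height x ^ n)⁻¹ ≤ (a ^ n)⁻¹ :=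
        inv_anti₀ (by positivity) (pow_le_pow_left₀ ha.le (hb' x hx).1 n)
      simp only [zpow_neg, zpow_natCast]
      refine mul_le_mul_of_nonneg_right ?_ (h0 x)
      have : 0 < b ^ n := by positivity
      linarith
    · simp [hφ.eq_zero hx]

theorem neg_integral_hypLap_mul_le {φ : Coord n → ℝ} (hφ : IsTest Ω φ) :
    -∫ x, hypLap φ x * φ x ∂(vol Ω) ≤ ‖hφ.hypLap.toLp‖ * ‖hφ.toLp‖ := by
  rw [← inner_toLp_toLp hφ.hypLap hφ]
  linarith [(abs_le.1 (abs_real_inner_le_norm hφ.hypLap.toLp hφ.toLp)).1]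

/-- The Laplacian controls the function and its gradient. -/
theorem BoundedDomain.exists_norm_le (Ω : BoundedDomain n) : ∃ C : ℝ, 0 < C ∧
    ∀ φ : Coord n → ℝ, ∀ hφ : IsTest Ω φ, ‖hφ.toLp‖ ≤ C * ‖hφ.hypLap.toLp‖ ∧
      energy φ ≤ C * ‖hφ.hypLap.toLp‖ ^ 2 := by
  obtain ⟨a, b, C, ha, hb, hC, hab, hcmp⟩ := Ω.exists_comparison
  -- The Euclidean energy is bounded by the hyperbolic one, which equals -⟨Δφ, φ⟩ by Green's
  -- formula.
  have hen : ∀ φ : Coord n → ℝ, ∀ hφ : IsTest Ω φ,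
      energy φ ≤ C / a ^ 2 * (‖hφ.hypLap.toLp‖ * ‖hφ.toLp‖) := by
    intro φ hφ
    have h1 : energy φ ≤ C / a ^ 2 * ∑ j, ∫ x, height x ^ 2 * (pd j φ x * pd j φ x) ∂(vol Ω) := by
      rw [energy, Finset.mul_sum]
      refine Finset.sum_le_sum fun j _ => ?_
      refine (hcmp _ (hφ.pd j).sq fun x => sq_nonneg _).1.trans ?_
      rw [div_mul_eq_mul_div, mul_div_assoc]
      refine mul_le_mul_of_nonneg_left ?_ hC.le
      rw [le_div_iff₀ (by positivity), ← integral_mul_const]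
      refine integral_mono ((hφ.pd j).sq.integrable_vol.mul_const _)
        (((hφ.pd j).mul (hφ.pd j)).pow_mul 2).integrable_vol fun x => ?_
      by_cases hx : x ∈ Ω.carrier
      · have : a ^ 2 ≤ height x ^ 2 := pow_le_pow_left₀ ha.le (hab x hx).1 2
        simp only
        nlinarith [sq_nonneg (pd j φ x)]
      · simp [(hφ.pd j).eq_zero hx]
    refine h1.trans (mul_le_mul_of_nonneg_left ?_ (by positivity))
    have := neg_integral_hypLap_mul_le hφ
    rwa [integral_hypLap_mul hφ hφ, neg_neg] at this
  set D := C * ((2 * b + 1) ^ 2 * (C / a ^ 2)) with hD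
  have hD0 : 0 < D := by positivity
  have hN : ∀ φ : Coord n → ℝ, ∀ hφ : IsTest Ω φ, ‖hφ.toLp‖ ≤ D * ‖hφ.hypLap.toLp‖ := by
    intro φ hφ
    rcases (norm_nonneg hφ.toLp).eq_or_lt with h0 | h0
    · rw [← h0]; positivity
    -- Poincaré and the energy bound; one factor ‖φ‖ is then cancelled.
    have h1 : ‖hφ.toLp‖ ^ 2 ≤ D * (‖hφ.hypLap.toLp‖ * ‖hφ.toLp‖) := by
      rw [norm_toLp_sq]
      refine (hcmp _ hφ.sq fun x => sq_nonneg _).2.trans ?_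
      rw [hD, mul_assoc, mul_assoc]
      refine mul_le_mul_of_nonneg_left ?_ hC.le
      refine (integral_sq_le_energy (hφ.smooth.of_le (by simp)) hφ.compact hb.le
        fun x hx => ?_).trans (mul_le_mul_of_nonneg_left (hen φ hφ) (by positivity))
      by_contra hxb
      exact hx (hφ.eq_zero fun hxΩ => hxb (hab x hxΩ).2.2)
    nlinarith
  refine ⟨D + C / a ^ 2 * D, by positivity, fun φ hφ => ⟨(hN φ hφ).trans ?_, (hen φ hφ).trans ?_⟩⟩
  · refine mul_le_mul_of_nonneg_right ?_ (norm_nonneg _)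
    have : 0 < C / a ^ 2 * D := by positivity
    linarith
  · have h1 : ‖hφ.hypLap.toLp‖ * ‖hφ.toLp‖ ≤ D * ‖hφ.hypLap.toLp‖ ^ 2 := by
      nlinarith [hN φ hφ, norm_nonneg hφ.hypLap.toLp]
    have h2 := mul_le_mul_of_nonneg_left h1 (by positivity : 0 ≤ C / a ^ 2)
    nlinarith [sq_nonneg ‖hφ.hypLap.toLp‖]

theorem pd_comm {n : ℕ} {φ : Coord n → ℝ} (hφ : ContDiff ℝ ∞ φ) (a b : Fin n) :
    pd a (pd b φ) = pd b (pd a φ) := by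
  have h1 : ∀ x, DifferentiableAt ℝ (fderiv ℝ φ) x := fun x =>
    ((hφ.fderiv_right (m := ∞) (by simp)).differentiable (by simp)) x
  have h2 : ∀ c d : Fin n, ∀ x, pd c (pd d φ) x =
      fderiv ℝ (fderiv ℝ φ) x (EuclideanSpace.single c 1) (EuclideanSpace.single d 1) := by
    intro c d x
    have := fderiv_clm_apply (h1 x) (differentiableAt_const (EuclideanSpace.single d (1 : ℝ)))
    change fderiv ℝ (fun y => fderiv ℝ φ y (EuclideanSpace.single d 1)) x _ = _
    rw [this]
    simp
  funext x
  rw [h2, h2]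
  exact (hφ.contDiffAt.isSymmSndFDerivAt (by
    rw [minSmoothness_of_isRCLikeNormedField]; exact WithTop.coe_le_coe.2 (le_top : (2 : ℕ∞) ≤ ⊤))) _ _

/-- Integrating by parts twice and commuting derivatives turns ∫ (∂_a∂_bφ)² into ∫ ∂_a²φ ∂_b²φ. Thus
the flat Laplacian controls the full Hessian. -/
theorem integral_pd_pd_sq {φ : Coord n → ℝ} (hφ : IsTest Ω φ) :
    ∑ a, ∑ b, ∫ x, pd a (pd b φ) x ^ 2 = ∫ x, (∑ j, pd j (pd j φ) x) ^ 2 := by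
  have h1 : ∀ a b, ∫ x, pd a (pd b φ) x ^ 2 = ∫ x, pd a (pd a φ) x * pd b (pd b φ) x := by
    intro a b
    rw [integral_pd_mul a (hφ.pd a) ((hφ.pd b).pd b), pd_comm (hφ.pd b).smooth a b,
      ← integral_pd_mul b (hφ.pd a) ((hφ.pd b).pd a), pd_comm hφ.smooth b a]
    simp only [sq]
  have h2 : ∀ x, (∑ j, pd j (pd j φ) x) ^ 2 = ∑ a, ∑ b, pd a (pd a φ) x * pd b (pd b φ) x := by
    intro x
    rw [sq, Finset.sum_mul_sum]
  simp only [h1, h2]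
  have hi : ∀ a b, Integrable fun x => pd a (pd a φ) x * pd b (pd b φ) x := fun a b =>
    (((hφ.pd a).pd a).mul ((hφ.pd b).pd b)).integrable
  rw [integral_finsetSum _ fun a _ => integrable_finsetSum _ fun b _ => hi a b]
  refine Finset.sum_congr rfl fun a _ => ?_
  rw [integral_finsetSum _ fun b _ => hi a b]

/-- The elliptic estimate: the Laplacian controls the second derivatives. -/
theorem BoundedDomain.exists_norm_pd_le (Ω : BoundedDomain n) : ∃ C : ℝ, 0 < C ∧
    ∀ φ : Coord n → ℝ, ∀ hφ : IsTest Ω φ, (∀ a, ‖(hφ.pd a).toLp‖ ≤ C * ‖hφ.hypLap.toLp‖) ∧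
      ∀ a b, ‖((hφ.pd b).pd a).toLp‖ ≤ C * ‖hφ.hypLap.toLp‖ := by
  obtain ⟨a₀, b₀, C, ha, hb, hC, hab, hcmp⟩ := Ω.exists_comparison
  obtain ⟨D, hD, hφD⟩ := Ω.exists_norm_le
  have h1 : ∀ φ : Coord n → ℝ, ∀ hφ : IsTest Ω φ, ∀ a,
      ‖(hφ.pd a).toLp‖ ^ 2 ≤ C * D * ‖hφ.hypLap.toLp‖ ^ 2 := by
    intro φ hφ a
    rw [norm_toLp_sq, mul_assoc]
    refine (hcmp _ (hφ.pd a).sq fun x => sq_nonneg _).2.trans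
      (mul_le_mul_of_nonneg_left (le_trans ?_ (hφD φ hφ).2) hC.le)
    exact Finset.single_le_sum (f := fun j => ∫ x, pd j φ x ^ 2)
      (fun j _ => integral_nonneg fun x => sq_nonneg _) (Finset.mem_univ a)
  set M := 2 / a₀ ^ 4 * (1 + ((n : ℝ) - 2) ^ 2 * b₀ ^ 2 * (C * D)) with hM
  have h2 : ∀ φ : Coord n → ℝ, ∀ hφ : IsTest Ω φ, ∀ a b,
      ‖((hφ.pd b).pd a).toLp‖ ^ 2 ≤ C * (C * M) * ‖hφ.hypLap.toLp‖ ^ 2 := by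
    intro φ hφ a b
    have hE : IsTest Ω fun x => ∑ j, pd j (pd j φ) x := by
      have := IsTest.sum Finset.univ fun j (_ : j ∈ Finset.univ) => (hφ.pd j).pd j
      convert this using 1
      funext x
      simp
    rw [norm_toLp_sq, mul_assoc, mul_assoc]
    refine (hcmp _ ((hφ.pd b).pd a).sq fun x => sq_nonneg _).2.trans
      (mul_le_mul_of_nonneg_left ?_ hC.le)
    have h3 : ∫ x, pd a (pd b φ) x ^ 2 ≤ ∫ x, (∑ j, pd j (pd j φ) x) ^ 2 := by
      rw [← integral_pd_pd_sq hφ]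
      have hnn : ∀ a b, 0 ≤ ∫ x, pd a (pd b φ) x ^ 2 := fun a b =>
        integral_nonneg fun x => sq_nonneg _
      exact (Finset.single_le_sum (f := fun b => ∫ x, pd a (pd b φ) x ^ 2)
        (fun b _ => hnn a b) (Finset.mem_univ b)).trans
        (Finset.single_le_sum (f := fun a => ∑ b, ∫ x, pd a (pd b φ) x ^ 2)
        (fun a _ => Finset.sum_nonneg fun b _ => hnn a b) (Finset.mem_univ a))
    refine h3.trans ((hcmp _ hE.sq fun x => sq_nonneg _).1.trans
      (mul_le_mul_of_nonneg_left ?_ hC.le))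
    -- The flat Laplacian is recovered from x_n² ∑ ∂_j²φ = Δφ + (n - 2) x_n ∂_nφ; the first-order
    -- term is already under control by `h1`.
    have h4 : ∫ x, (∑ j, pd j (pd j φ) x) ^ 2 ∂(vol Ω) ≤
        2 / a₀ ^ 4 * (∫ x, hypLap φ x ^ 2 ∂(vol Ω) +
          ((n : ℝ) - 2) ^ 2 * b₀ ^ 2 * ∫ x, pd (lastIdx n) φ x ^ 2 ∂(vol Ω)) := by
      rw [← integral_const_mul, ← integral_add hφ.hypLap.sq.integrable_vol
        ((hφ.pd _).sq.integrable_vol.const_mul _), ← integral_const_mul]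
      refine integral_mono hE.sq.integrable_vol ((hφ.hypLap.sq.integrable_vol.add
        ((hφ.pd _).sq.integrable_vol.const_mul _)).const_mul _) fun x => ?_
      by_cases hx : x ∈ Ω.carrier
      · have hp := height_pos Ω hx
        obtain ⟨hx1, hx2, -⟩ := hab x hx
        have e1 : height x ^ 2 * ∑ j, pd j (pd j φ) x =
            hypLap φ x + ((n : ℝ) - 2) * height x * pd (lastIdx n) φ x := by
          rw [hypLap]; ring
        have e2 : (height x ^ 2 * ∑ j, pd j (pd j φ) x) ^ 2 ≤
            2 * (hypLap φ x ^ 2 + ((n : ℝ) - 2) ^ 2 * b₀ ^ 2 * pd (lastIdx n) φ x ^ 2) := by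
          rw [e1]
          have h5 : height x ^ 2 ≤ b₀ ^ 2 := pow_le_pow_left₀ hp.le hx2 2
          have h6 := mul_le_mul_of_nonneg_right h5
            (sq_nonneg (((n : ℝ) - 2) * pd (lastIdx n) φ x))
          nlinarith [sq_nonneg (hypLap φ x - ((n : ℝ) - 2) * height x * pd (lastIdx n) φ x)]
        have e3 : a₀ ^ 4 * (∑ j, pd j (pd j φ) x) ^ 2 ≤
            (height x ^ 2 * ∑ j, pd j (pd j φ) x) ^ 2 := by
          rw [mul_pow, ← pow_mul]
          exact mul_le_mul_of_nonneg_right (pow_le_pow_left₀ ha.le hx1 4) (sq_nonneg _)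
        simp only
        rw [div_mul_eq_mul_div, le_div_iff₀ (by positivity), mul_comm]
        exact e3.trans e2
      · rw [hE.eq_zero hx, hφ.hypLap.eq_zero hx, (hφ.pd _).eq_zero hx]
        simp
    refine h4.trans ?_
    have h5 := h1 φ hφ (lastIdx n)
    rw [norm_toLp_sq] at h5
    rw [← norm_toLp_sq hφ.hypLap, hM, mul_assoc (2 / a₀ ^ 4)]
    refine mul_le_mul_of_nonneg_left ?_ (by positivity)
    have h6 := mul_le_mul_of_nonneg_left h5
      (by positivity : 0 ≤ ((n : ℝ) - 2) ^ 2 * b₀ ^ 2)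
    linarith
  have hM0 : 0 ≤ M := by positivity
  have hS : ∀ {s t K L : ℝ}, 0 ≤ t → K ≤ L → 0 ≤ L → s ^ 2 ≤ K * t ^ 2 → s ≤ √L * t := by
    intro s t K L ht hKL hL h
    refine le_of_abs_le (abs_le_of_sq_le_sq (h.trans ?_) (by positivity))
    rw [mul_pow, Real.sq_sqrt hL]
    exact mul_le_mul_of_nonneg_right hKL (sq_nonneg _)
  have hCD : 0 < C * D := by positivity
  have hCM : 0 ≤ C * (C * M) := by positivity
  exact ⟨√(C * D + C * (C * M)), Real.sqrt_pos.2 (by linarith), fun φ hφ =>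
    ⟨fun a => hS (norm_nonneg _) (by linarith) (by linarith) (h1 φ hφ a),
      fun a b => hS (norm_nonneg _) (by linarith) (by linarith) (h2 φ hφ a b)⟩⟩

end

end HypClamped

namespace HypClamped

noncomputable section

open scoped RealInnerProductSpace

variable {n : ℕ} [NeZero n] {Ω : BoundedDomain n}

/-! ### The graph of the operators on test functions -/

theorem hypLap_add {φ ψ : Coord n → ℝ} (hφ : ContDiff ℝ ∞ φ) (hψ : ContDiff ℝ ∞ ψ) :
    hypLap (φ + ψ) = hypLap φ + hypLap ψ := by
  have h : ∀ {χ : Coord n → ℝ}, ContDiff ℝ ∞ χ → ∀ a, ContDiff ℝ ∞ (pd a χ) := fun hχ a =>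
    (hχ.fderiv_right (m := ∞) (by simp)).clm_apply contDiff_const
  funext x
  simp only [hypLap, pd_add _ hφ hψ, pd_add _ (h hφ _) (h hψ _), Pi.add_apply,
    Finset.sum_add_distrib]
  ring

theorem hypLap_smul (c : ℝ) {φ : Coord n → ℝ} (hφ : ContDiff ℝ ∞ φ) :
    hypLap (c • φ) = c • hypLap φ := by
  have h : ∀ {χ : Coord n → ℝ}, ContDiff ℝ ∞ χ → ∀ a, ContDiff ℝ ∞ (pd a χ) := fun hχ a =>
    (hχ.fderiv_right (m := ∞) (by simp)).clm_apply contDiff_const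
  funext x
  simp only [hypLap, pd_smul _ c hφ, pd_smul _ c (h hφ _), Pi.smul_apply, smul_eq_mul,
    ← Finset.mul_sum]
  ring

theorem bop_add {φ ψ : Coord n → ℝ} (hφ : ContDiff ℝ ∞ φ) (hψ : ContDiff ℝ ∞ ψ) :
    bop (φ + ψ) = bop φ + bop ψ := by
  funext x
  simp only [bop, pd_add _ hφ hψ, Pi.add_apply]
  ring

theorem bop_smul (c : ℝ) {φ : Coord n → ℝ} (hφ : ContDiff ℝ ∞ φ) :
    bop (c • φ) = c • bop φ := by
  funext x
  simp only [bop, pd_smul _ c hφ, Pi.smul_apply, smul_eq_mul]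
  ring

variable (Ω) in
/-- The space `C_c^∞(Ω)`. -/
def testSpace : Submodule ℝ (Coord n → ℝ) where
  carrier := {φ | IsTest Ω φ}
  zero_mem' := IsTest.zero
  add_mem' := IsTest.add
  smul_mem' := fun c _ h => h.smul c

variable (Ω) in
/-- The embedding of `C_c^∞(Ω)` into `L²(Ω)`. -/
def testLp : testSpace Ω →ₗ[ℝ] Lp ℝ 2 (vol Ω) where
  toFun φ := IsTest.toLp φ.2
  map_add' _ _ := rfl
  map_smul' _ _ := rfl

variable (Ω) in
/-- The coordinate derivatives on `C_c^∞(Ω)`. -/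
def pdTest (a : Fin n) : testSpace Ω →ₗ[ℝ] testSpace Ω where
  toFun φ := ⟨pd a φ, IsTest.pd a φ.2⟩
  map_add' φ ψ := Subtype.ext (pd_add a φ.2.smooth ψ.2.smooth)
  map_smul' c φ := Subtype.ext (pd_smul a c φ.2.smooth)

variable (Ω) in
/-- The Laplacian on `C_c^∞(Ω)`. -/
def lapTest : testSpace Ω →ₗ[ℝ] testSpace Ω where
  toFun φ := ⟨hypLap φ, IsTest.hypLap φ.2⟩
  map_add' φ ψ := Subtype.ext (hypLap_add φ.2.smooth ψ.2.smooth)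
  map_smul' c φ := Subtype.ext (hypLap_smul c φ.2.smooth)

variable (Ω) in
/-- The commutator of the Laplacian with `log x_n` on `C_c^∞(Ω)`. -/
def bopTest : testSpace Ω →ₗ[ℝ] testSpace Ω where
  toFun φ := ⟨bop φ, IsTest.bop φ.2⟩
  map_add' φ ψ := Subtype.ext (bop_add φ.2.smooth ψ.2.smooth)
  map_smul' c φ := Subtype.ext (bop_smul c φ.2.smooth)

variable (Ω) in
/-- The triples `(φ, [Δ, log x_n] φ, Δ φ)`. -/
def testTriple : testSpace Ω →ₗ[ℝ] Lp ℝ 2 (vol Ω) × Lp ℝ 2 (vol Ω) × Lp ℝ 2 (vol Ω) :=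
  (testLp Ω).prod ((testLp Ω ∘ₗ bopTest Ω).prod (testLp Ω ∘ₗ lapTest Ω))

variable (Ω) in
/-- The closed graph `{(u, [Δ, log x_n] u, Δ u) : u ∈ H²₀(Ω)}`. -/
def graph : Submodule ℝ (Lp ℝ 2 (vol Ω) × Lp ℝ 2 (vol Ω) × Lp ℝ 2 (vol Ω)) :=
  (LinearMap.range (testTriple Ω)).topologicalClosure

theorem testTriple_mem_graph (φ : testSpace Ω) : testTriple Ω φ ∈ graph Ω :=
  subset_closure ⟨φ, rfl⟩

theorem isClosed_graph :
    IsClosed (graph Ω : Set (Lp ℝ 2 (vol Ω) × Lp ℝ 2 (vol Ω) × Lp ℝ 2 (vol Ω))) :=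
  isClosed_closure

theorem exists_tendsto_of_mem_graph {X : Lp ℝ 2 (vol Ω) × Lp ℝ 2 (vol Ω) × Lp ℝ 2 (vol Ω)}
    (hX : X ∈ graph Ω) :
    ∃ φ : ℕ → testSpace Ω, Tendsto (fun j => testTriple Ω (φ j)) atTop (𝓝 X) := by
  obtain ⟨x, hx, hlim⟩ := mem_closure_iff_seq_limit.1 hX
  choose φ hφ using hx
  exact ⟨φ, by simpa only [hφ] using hlim⟩

/-- Extends closed conditions from test functions to the graph. Relations between two elements of
the graph use it once in each variable. -/
theorem graph_induction {P : Lp ℝ 2 (vol Ω) × Lp ℝ 2 (vol Ω) × Lp ℝ 2 (vol Ω) → Prop}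
    (hP : IsClosed {X | P X}) (h : ∀ φ, P (testTriple Ω φ)) : ∀ X ∈ graph Ω, P X := by
  intro X hX
  obtain ⟨φ, hφ⟩ := exists_tendsto_of_mem_graph hX
  exact hP.mem_of_tendsto hφ (Eventually.of_forall fun j => h (φ j))

theorem graph_skew : ∀ X ∈ graph Ω, ∀ Y ∈ graph Ω, ⟪X.2.1, Y.1⟫ = -⟪X.1, Y.2.1⟫ := by
  refine graph_induction ?_ fun φ => graph_induction ?_ fun ψ => ?_
  · simp only [Set.ofPred_forall]
    exact isClosed_iInter fun Y => isClosed_iInter fun _ =>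
      isClosed_eq (by fun_prop) (by fun_prop)
  · exact isClosed_eq (by fun_prop) (by fun_prop)
  · have hφ : IsTest Ω φ := φ.2
    have hψ : IsTest Ω ψ := ψ.2
    change ⟪hφ.bop.toLp, hψ.toLp⟫ = -⟪hφ.toLp, hψ.bop.toLp⟫
    rw [inner_toLp_toLp, inner_toLp_toLp]
    exact integral_bop_mul hφ hψ

theorem graph_symm : ∀ X ∈ graph Ω, ∀ Y ∈ graph Ω, ⟪X.2.2, Y.1⟫ = ⟪X.1, Y.2.2⟫ := by
  refine graph_induction ?_ fun φ => graph_induction ?_ fun ψ => ?_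
  · simp only [Set.ofPred_forall]
    exact isClosed_iInter fun Y => isClosed_iInter fun _ =>
      isClosed_eq (by fun_prop) (by fun_prop)
  · exact isClosed_eq (by fun_prop) (by fun_prop)
  · have hφ : IsTest Ω φ := φ.2
    have hψ : IsTest Ω ψ := ψ.2
    change ⟪hφ.hypLap.toLp, hψ.toLp⟫ = ⟪hφ.toLp, hψ.hypLap.toLp⟫
    rw [inner_toLp_toLp, inner_toLp_toLp]
    exact integral_hypLap_mul_comm hφ hψ

theorem graph_hardy : ∀ X ∈ graph Ω,
    ‖X.2.1‖ ^ 2 + ((n : ℝ) - 1) ^ 2 * ‖X.1‖ ^ 2 ≤ -4 * ⟪X.2.2, X.1⟫ := by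
  refine graph_induction (isClosed_le (by fun_prop) (by fun_prop)) fun φ => ?_
  have hφ : IsTest Ω φ := φ.2
  change ‖hφ.bop.toLp‖ ^ 2 + ((n : ℝ) - 1) ^ 2 * ‖hφ.toLp‖ ^ 2 ≤
    -4 * ⟪hφ.hypLap.toLp, hφ.toLp⟫
  rw [← real_inner_self_eq_norm_sq, ← real_inner_self_eq_norm_sq, inner_toLp_toLp,
    inner_toLp_toLp, inner_toLp_toLp]
  exact integral_bop_sq_add_le hφ

variable (Ω) in
theorem exists_graph_norm_le : ∃ C : ℝ, ∀ X ∈ graph Ω, ‖X.1‖ ≤ C * ‖X.2.2‖ := by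
  obtain ⟨C, -, hC⟩ := Ω.exists_norm_le
  exact ⟨C, graph_induction (isClosed_le (by fun_prop) (by fun_prop)) fun φ => (hC φ φ.2).1⟩

/-! ### Multiplication operators -/

/-- Multiplication by a bounded function on `L²(Ω)`. -/
def mulOp (m : Coord n → ℝ) (hm : MemLp m ∞ (vol Ω)) :
    Lp ℝ 2 (vol Ω) →L[ℝ] Lp ℝ 2 (vol Ω) :=
  (ContinuousLinearMap.mul ℝ ℝ).holderL (vol Ω) ∞ 2 2 (hm.toLp m)

theorem coeFn_mulOp {m : Coord n → ℝ} (hm : MemLp m ∞ (vol Ω)) (u : Lp ℝ 2 (vol Ω)) :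
    mulOp m hm u =ᵐ[vol Ω] fun x => m x * u x := by
  have h := (ContinuousLinearMap.mul ℝ ℝ).coeFn_holder (r := 2) (hm.toLp m) u
  filter_upwards [h, hm.coeFn_toLp] with x hx hx2
  rw [hx2] at hx
  exact hx

theorem mulOp_toLp {m : Coord n → ℝ} (hm : MemLp m ∞ (vol Ω)) {φ : Coord n → ℝ}
    (hφ : IsTest Ω φ) (hmφ : IsTest Ω (m * φ)) : mulOp m hm hφ.toLp = hmφ.toLp := by
  refine Lp.ext ?_
  filter_upwards [coeFn_mulOp hm hφ.toLp, hφ.coeFn_toLp, hmφ.coeFn_toLp] with x h1 h2 h3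
  rw [h1, h2, h3, Pi.mul_apply]

theorem mulOp_symm {m : Coord n → ℝ} (hm : MemLp m ∞ (vol Ω)) (u v : Lp ℝ 2 (vol Ω)) :
    ⟪mulOp m hm u, v⟫ = ⟪u, mulOp m hm v⟫ := by
  rw [inner_eq_integral_mul, inner_eq_integral_mul]
  refine integral_congr_ae ?_
  filter_upwards [coeFn_mulOp hm u, coeFn_mulOp hm v] with x h1 h2
  rw [h1, h2]
  ring

theorem memLp_top_of_bound_on {m : Coord n → ℝ} (hm : Measurable m) {C : ℝ}
    (hC : ∀ x ∈ Ω.carrier, |m x| ≤ C) : MemLp m ∞ (vol Ω) := by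
  refine memLp_top_of_bound hm.aestronglyMeasurable C ?_
  rw [vol]
  filter_upwards [ae_restrict_mem Ω.isOpen.measurableSet] with x hx using hC x hx

variable (Ω) in
theorem memLp_top_height : MemLp (height : Coord n → ℝ) ∞ (vol Ω) := by
  obtain ⟨a, b, ha, hab⟩ := Ω.exists_bounds
  exact memLp_top_of_bound_on (C := b) contDiff_height.continuous.measurable fun x hx =>
    (abs_height_le x).trans (hab x hx).2

variable (Ω) in
theorem memLp_top_height_sq : MemLp (fun x : Coord n => height x ^ 2) ∞ (vol Ω) := by
  obtain ⟨a, b, ha, hab⟩ := Ω.exists_bounds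
  refine memLp_top_of_bound_on (C := b ^ 2) (contDiff_height.continuous.pow 2).measurable
    fun x hx => ?_
  rw [abs_pow]
  exact pow_le_pow_left₀ (abs_nonneg _) ((abs_height_le x).trans (hab x hx).2) 2

variable (Ω) in
-- The multiplier log x_n is bounded because the height on `Ω` lies between two positive constants.
theorem memLp_top_log_height : MemLp (fun x : Coord n => Real.log (height x)) ∞ (vol Ω) := by
  obtain ⟨a, b, ha, hab⟩ := Ω.exists_bounds
  refine memLp_top_of_bound_on (C := max (-Real.log a) (Real.log b))
    (Real.measurable_log.comp contDiff_height.continuous.measurable) fun x hx => ?_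
  have hp := height_pos Ω hx
  have h1 := Real.log_le_log ha (hab x hx).1
  have h2 := Real.log_le_log hp ((le_abs_self _).trans ((abs_height_le x).trans (hab x hx).2))
  refine abs_le.2 ⟨?_, h2.trans (le_max_right _ _)⟩
  linarith [le_max_left (-Real.log a) (Real.log b)]

variable (Ω) in
/-- Multiplication by `log x_n`. -/
def logOp : Lp ℝ 2 (vol Ω) →L[ℝ] Lp ℝ 2 (vol Ω) := mulOp _ (memLp_top_log_height Ω)

/-- The two commutator identities hold on test functions, and the map on triples is continuous since
log x_n acts boundedly. -/
theorem graph_logOp : ∀ X ∈ graph Ω,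
    (logOp Ω X.1, logOp Ω X.2.1 + (2 : ℝ) • X.1, logOp Ω X.2.2 + X.2.1) ∈ graph Ω := by
  refine graph_induction (isClosed_graph.preimage (by fun_prop)) fun φ => ?_
  have hφ : IsTest Ω φ := φ.2
  have h : (logOp Ω (testTriple Ω φ).1, logOp Ω (testTriple Ω φ).2.1 + (2 : ℝ) • (testTriple Ω φ).1,
      logOp Ω (testTriple Ω φ).2.2 + (testTriple Ω φ).2.1) =
      testTriple Ω ⟨_, hφ.log_mul⟩ := by
    refine Prod.ext ?_ (Prod.ext ?_ ?_)
    · exact mulOp_toLp _ hφ hφ.log_mul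
    · change mulOp _ _ hφ.bop.toLp + (2 : ℝ) • hφ.toLp = hφ.log_mul.bop.toLp
      rw [mulOp_toLp _ hφ.bop hφ.bop.log_mul]
      simp only [bop_log_mul hφ]
      rfl
    · change mulOp _ _ hφ.hypLap.toLp + hφ.bop.toLp = hφ.log_mul.hypLap.toLp
      rw [mulOp_toLp _ hφ.hypLap hφ.hypLap.log_mul]
      simp only [hypLap_log_mul hφ]
      rfl
  rw [h]
  exact testTriple_mem_graph _

/-! ### Rellich's theorem -/

/-- If up to ε finitely many bounded numbers determine `s a`, a finite net for their values in ℝ^K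
pulls back to a finite ε-net. -/
theorem totallyBounded_range_of_forall_finite {α E : Type*} [PseudoMetricSpace E] {s : α → E}
    (h : ∀ ε > (0 : ℝ), ∃ (K : Type) (_ : Fintype K) (J : α → K → ℝ),
      (∃ R : ℝ, ∀ a k, |J a k| ≤ R) ∧
      ∃ η > (0 : ℝ), ∀ a b, (∀ k, |J a k - J b k| < η) → dist (s a) (s b) < ε) :
    TotallyBounded (Set.range s) := by
  rw [Metric.totallyBounded_iff]
  intro ε hε
  obtain ⟨K, _, J, ⟨R, hR⟩, η, hη, hJ⟩ := h ε hε
  have htb : TotallyBounded (Set.range J) := by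
    refine TotallyBounded.subset ?_ (isCompact_closedBall (0 : K → ℝ) (max R 0)).totallyBounded
    rintro _ ⟨a, rfl⟩
    rw [mem_closedBall_zero_iff, pi_norm_le_iff_of_nonneg (le_max_right _ _)]
    exact fun k => (hR a k).trans (le_max_left _ _)
  obtain ⟨t, hts, htf, ht⟩ := Metric.finite_approx_of_totallyBounded htb η hη
  choose c hc using hts
  have : Finite t := htf
  refine ⟨Set.range fun y : t => s (c y.2), Set.finite_range _, ?_⟩
  rintro _ ⟨a, rfl⟩
  obtain ⟨y, hy, hay⟩ := Set.mem_iUnion₂.1 (ht ⟨a, rfl⟩)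
  refine Set.mem_iUnion₂.2 ⟨_, ⟨⟨y, hy⟩, rfl⟩, ?_⟩
  refine hJ a (c hy) fun k => ?_
  rw [hc hy]
  exact (dist_le_pi_dist (J a) y k).trans_lt hay

theorem exists_cells_cover {n : ℕ} {δ : ℝ} (hδ : 0 < δ) (b : ℝ) : ∃ K : Finset (Fin n → ℤ),
    ∀ x : Coord n, ‖x‖ ≤ b → ∃ k ∈ K, x ∈ cell δ k := by
  refine ⟨Fintype.piFinset fun _ => Finset.Icc ⌊-b / δ⌋ ⌊b / δ⌋, fun x hx =>
    ⟨fun i => ⌊x i / δ⌋, ?_, fun i => rfl⟩⟩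
  rw [Fintype.mem_piFinset]
  intro i
  have h := abs_le.1 ((PiLp.norm_apply_le x i).trans hx)
  rw [Finset.mem_Icc]
  exact ⟨Int.floor_mono (div_le_div_of_nonneg_right h.1 hδ.le),
    Int.floor_mono (div_le_div_of_nonneg_right h.2 hδ.le)⟩

variable (Ω) in
-- The finitely many numbers are the integrals over cells. A fine mesh makes the energy error at
-- most ε²/4, and closeness of the cell integrals then bounds the rest by ε²/4.
theorem totallyBounded_test : TotallyBounded (Set.range
    fun φ : {φ : testSpace Ω // ‖testLp Ω (lapTest Ω φ)‖ ≤ 2} => testLp Ω φ) := by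
  obtain ⟨a, b, C, ha, hb, hC, hab, hcmp⟩ := Ω.exists_comparison
  obtain ⟨D, hD, hφD⟩ := Ω.exists_norm_le
  refine totallyBounded_range_of_forall_finite fun ε hε => ?_
  have hn : 0 < (n : ℝ) := Nat.cast_pos.2 (NeZero.pos n)
  -- The factor 4² bounds ‖Δ(φ - ψ)‖², each of the two Laplacians having norm at most 2.
  set A := C * (2 ^ n * n * (D * 4 ^ 2)) with hA
  have hA0 : 0 < A := by positivity
  set δ := √(ε ^ 2 / (4 * A)) with hδdef
  have hδ : 0 < δ := Real.sqrt_pos.2 (by positivity)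
  have hδ2 : A * δ ^ 2 = ε ^ 2 / 4 := by
    rw [hδdef, Real.sq_sqrt (by positivity)]
    field_simp
  obtain ⟨K, hK⟩ := exists_cells_cover (n := n) hδ b
  set B := C * ((δ ^ n)⁻¹ * (K.card + 1)) with hB
  have hB0 : 0 < B := by positivity
  set η := √(ε ^ 2 / (4 * B)) with hηdef
  have hη : 0 < η := Real.sqrt_pos.2 (by positivity)
  have hη2 : B * η ^ 2 = ε ^ 2 / 4 := by
    rw [hηdef, Real.sq_sqrt (by positivity)]
    field_simp
  refine ⟨K, inferInstance, fun φ k => ∫ x in cell δ k, (φ : Coord n → ℝ) x,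
    ⟨√(δ ^ n * (C * (D * 2) ^ 2)), fun φ k => ?_⟩, η, hη, fun φ ψ hφψ => ?_⟩
  · have hφ : IsTest Ω φ := φ.1.2
    have hfin : volume (cell δ (k : Fin n → ℤ)) ≠ ⊤ := by
      rw [volume_cell hδ]; exact ENNReal.ofReal_ne_top
    have hreal : volume.real (cell δ (k : Fin n → ℤ)) = δ ^ n := by
      rw [measureReal_def, volume_cell hδ, ENNReal.toReal_ofReal (by positivity)]
    -- Nonnegativity of the variance is the Cauchy–Schwarz bound for the cell integral.
    have h1 := setIntegral_setIntegral_sub_sq hfin hφ.integrable hφ.sq.integrable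
    have h2 : 0 ≤ ∫ x in cell δ k, ∫ y in cell δ k,
        ((φ : Coord n → ℝ) y - (φ : Coord n → ℝ) x) ^ 2 :=
      integral_nonneg fun x => integral_nonneg fun y => sq_nonneg _
    rw [h1, hreal] at h2
    refine Real.abs_le_sqrt ?_
    have h3 : ∫ x in cell δ k, (φ : Coord n → ℝ) x ^ 2 ≤ ∫ x, (φ : Coord n → ℝ) x ^ 2 :=
      setIntegral_le_integral hφ.sq.integrable (Eventually.of_forall fun x => sq_nonneg _)
    have h4 := (hcmp _ hφ.sq fun x => sq_nonneg _).1
    rw [← norm_toLp_sq hφ] at h4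
    have h5 : ‖hφ.toLp‖ ≤ D * 2 :=
      (hφD _ hφ).1.trans (mul_le_mul_of_nonneg_left φ.2 hD.le)
    have h6 : ‖hφ.toLp‖ ^ 2 ≤ (D * 2) ^ 2 := pow_le_pow_left₀ (norm_nonneg _) h5 2
    have h7 := mul_le_mul_of_nonneg_left h6 hC.le
    have h8 := mul_le_mul_of_nonneg_left (h3.trans (h4.trans h7)) (pow_pos hδ n).le
    linarith
  · have hφ : IsTest Ω φ := φ.1.2
    have hψ : IsTest Ω ψ := ψ.1.2
    set χ : testSpace Ω := φ.1 - ψ.1 with hχdef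
    have hχ : IsTest Ω χ := χ.2
    have hlap : ‖hχ.hypLap.toLp‖ ≤ 4 := by
      have h1 : hχ.hypLap.toLp = testLp Ω (lapTest Ω φ) - testLp Ω (lapTest Ω ψ) := by
        rw [← map_sub, ← map_sub]
        rfl
      rw [h1]
      exact (norm_sub_le _ _).trans (by linarith [φ.2, ψ.2])
    have hdist : dist (testLp Ω φ) (testLp Ω ψ) = ‖hχ.toLp‖ := by
      rw [dist_eq_norm, ← map_sub]
      rfl
    have hlap2 : ‖hχ.hypLap.toLp‖ ^ 2 ≤ 4 ^ 2 := pow_le_pow_left₀ (norm_nonneg _) hlap 2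
    have hen : energy (χ : Coord n → ℝ) ≤ D * 4 ^ 2 :=
      (hφD _ hχ).2.trans (mul_le_mul_of_nonneg_left hlap2 hD.le)
    have h1 := integral_sq_le_sum_cell_add hδ (hχ.smooth.of_le (by simp)) hχ.compact
      (K := K) fun x hx => hK x <| by
        by_contra hxb
        exact hx (hχ.eq_zero fun hxΩ => hxb (hab x hxΩ).2.2)
    have h2 := (hcmp _ hχ.sq fun x => sq_nonneg _).2
    rw [← norm_toLp_sq hχ] at h2
    have h3 : ∑ k ∈ K, (∫ x in cell δ k, (χ : Coord n → ℝ) x) ^ 2 ≤ (K.card + 1) * η ^ 2 := by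
      have h4 : ∑ k ∈ K, (∫ x in cell δ k, (χ : Coord n → ℝ) x) ^ 2 ≤ ∑ _k ∈ K, η ^ 2 := by
        refine Finset.sum_le_sum fun k hk => ?_
        have h5 := hφψ ⟨k, hk⟩
        rw [← integral_sub hφ.integrable.integrableOn hψ.integrable.integrableOn] at h5
        exact sq_le_sq' (abs_lt.1 h5).1.le (abs_lt.1 h5).2.le
      rw [Finset.sum_const, nsmul_eq_mul] at h4
      nlinarith [sq_nonneg η]
    have h4 : ‖hχ.toLp‖ ^ 2 < ε ^ 2 := by
      have e1 := mul_le_mul_of_nonneg_left h3 (inv_pos.2 (pow_pos hδ n)).le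
      have e2 : 2 ^ n * (n * δ ^ 2 * energy (χ : Coord n → ℝ)) ≤
          2 ^ n * (n * δ ^ 2 * (D * 4 ^ 2)) := by gcongr
      have e3 := mul_le_mul_of_nonneg_left (h1.trans (add_le_add e1 e2)) hC.le
      have e4 : C * ((δ ^ n)⁻¹ * ((K.card + 1) * η ^ 2) + 2 ^ n * (n * δ ^ 2 * (D * 4 ^ 2))) =
          B * η ^ 2 + A * δ ^ 2 := by rw [hA, hB]; ring
      rw [e4, hη2, hδ2] at e3
      have : 0 < ε ^ 2 := by positivity
      linarith
    rw [hdist]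
    exact lt_of_pow_lt_pow_left₀ 2 hε.le h4

variable (Ω) in
/-- Rellich's theorem: `H²₀(Ω)` embeds compactly into `L²(Ω)`. -/
theorem totallyBounded_graph : TotallyBounded (Prod.fst ''
    {X : Lp ℝ 2 (vol Ω) × Lp ℝ 2 (vol Ω) × Lp ℝ 2 (vol Ω) | X ∈ graph Ω ∧ ‖X.2.2‖ ≤ 1}) := by
  refine TotallyBounded.subset ?_ (totallyBounded_test Ω).closure
  rintro _ ⟨X, ⟨hX, hX1⟩, rfl⟩
  obtain ⟨φ, hφ⟩ := exists_tendsto_of_mem_graph hX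
  have h1 : Tendsto (fun j => testLp Ω (φ j)) atTop (𝓝 X.1) := hφ.fst_nhds
  have h2 : Tendsto (fun j => testLp Ω (lapTest Ω (φ j))) atTop (𝓝 X.2.2) := hφ.snd_nhds.snd_nhds
  -- The approximants of an element with ‖Δu‖ ≤ 1 may exceed 1 slightly, whence the bound 2 for test
  -- functions.
  have h3 : ∀ᶠ j in atTop, ‖testLp Ω (lapTest Ω (φ j))‖ < 2 :=
    h2.norm.eventually (gt_mem_nhds (by linarith))
  refine mem_closure_of_tendsto h1 ?_
  filter_upwards [h3] with j hj using ⟨⟨φ j, hj.le⟩, rfl⟩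

end

end HypClamped

namespace HypClamped

noncomputable section

open scoped RealInnerProductSpace

variable {n : ℕ} [NeZero n] {Ω : BoundedDomain n}

/-! ### Eigenspaces in terms of the graph -/

theorem tendsto_toLp_iff {F : ℕ → Coord n → ℝ} (hF : ∀ j, IsTest Ω (F j)) (v : Lp ℝ 2 (vol Ω)) :
    Tendsto (fun j => (hF j).toLp) atTop (𝓝 v) ↔ L2Lim (vol Ω) F v := by
  rw [Lp.tendsto_Lp_iff_tendsto_eLpNorm', L2Lim]
  refine tendsto_congr fun j => eLpNorm_congr_ae ?_
  filter_upwards [(hF j).coeFn_toLp] with x hx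
  simp [hx]

/-- Convergence is inherited along an a priori estimate. -/
theorem exists_tendsto_of_norm_le {T E E' : Type*} [AddCommGroup T] [Module ℝ T]
    [NormedAddCommGroup E] [NormedSpace ℝ E] [CompleteSpace E] [NormedAddCommGroup E']
    [NormedSpace ℝ E'] (A : T →ₗ[ℝ] E) (L : T →ₗ[ℝ] E') {C : ℝ}
    (h : ∀ φ, ‖A φ‖ ≤ C * ‖L φ‖) {φ : ℕ → T} {w : E'}
    (hL : Tendsto (fun j => L (φ j)) atTop (𝓝 w)) :
    ∃ v, Tendsto (fun j => A (φ j)) atTop (𝓝 v) := by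
  refine cauchySeq_tendsto_of_complete ?_
  have h1 := cauchySeq_iff_tendsto_dist_atTop_0.1 hL.cauchySeq
  refine cauchySeq_iff_tendsto_dist_atTop_0.2 (squeeze_zero (fun _ => dist_nonneg) (fun p => ?_)
    (by simpa using h1.const_mul C))
  rw [dist_eq_norm, dist_eq_norm, ← map_sub, ← map_sub]
  exact h _

/-- By the elliptic estimate, convergence of Δφ_j forces all first and second coordinate derivatives
to converge. -/
theorem memH20_of_mem_graph {X : Lp ℝ 2 (vol Ω) × Lp ℝ 2 (vol Ω) × Lp ℝ 2 (vol Ω)}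
    (hX : X ∈ graph Ω) : MemH20 Ω X.1 := by
  obtain ⟨φ, hφ⟩ := exists_tendsto_of_mem_graph hX
  obtain ⟨C, -, hC⟩ := Ω.exists_norm_pd_le
  have ht : ∀ j, IsTest Ω (φ j) := fun j => (φ j).2
  have h1 : Tendsto (fun j => testLp Ω (φ j)) atTop (𝓝 X.1) := hφ.fst_nhds
  have h2 : Tendsto (fun j => (testLp Ω ∘ₗ lapTest Ω) (φ j)) atTop (𝓝 X.2.2) :=
    hφ.snd_nhds.snd_nhds
  have h3 := fun a => exists_tendsto_of_norm_le (testLp Ω ∘ₗ pdTest Ω a) (testLp Ω ∘ₗ lapTest Ω)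
    (C := C) (fun ψ => (hC ψ ψ.2).1 a) h2
  have h4 := fun a b => exists_tendsto_of_norm_le (testLp Ω ∘ₗ pdTest Ω a ∘ₗ pdTest Ω b)
    (testLp Ω ∘ₗ lapTest Ω) (C := C) (fun ψ => (hC ψ ψ.2).2 a b) h2
  choose d₁ hd₁ using h3
  choose d₂ hd₂ using h4
  exact ⟨fun j => φ j, d₁, d₂, ht, (tendsto_toLp_iff ht _).1 h1,
    fun a => (tendsto_toLp_iff (fun j => (ht j).pd a) _).1 (hd₁ a),
    fun a b => (tendsto_toLp_iff (fun j => ((ht j).pd b).pd a) _).1 (hd₂ a b)⟩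

/-- Expressed through bounded multiplications and coordinate derivatives, the operator visibly
respects the L² limits in `MemH20`; `toLp_hypLap` does the same for Δ. -/
theorem toLp_bop {φ : Coord n → ℝ} (hφ : IsTest Ω φ) : hφ.bop.toLp =
    (2 : ℝ) • mulOp _ (memLp_top_height Ω) (hφ.pd (lastIdx n)).toLp +
      (1 - (n : ℝ)) • hφ.toLp := by
  rw [mulOp_toLp _ (hφ.pd _) (IsTest.smooth_mul contDiff_height (hφ.pd _))]
  have h : bop φ = (2 : ℝ) • (height * pd (lastIdx n) φ) + (1 - (n : ℝ)) • φ := by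
    funext x
    simp [bop, mul_assoc]
  simp only [h]
  rfl

theorem toLp_sum {ι : Type*} (s : Finset ι) (φ : ι → Coord n → ℝ) (hφ : ∀ i, IsTest Ω (φ i)) :
    (IsTest.sum s fun i _ => hφ i).toLp = ∑ i ∈ s, (hφ i).toLp := by
  have h := map_sum (testLp Ω) (fun i => (⟨φ i, hφ i⟩ : testSpace Ω)) s
  have e : (∑ i ∈ s, (⟨φ i, hφ i⟩ : testSpace Ω)) =
      ⟨∑ i ∈ s, φ i, IsTest.sum s fun i _ => hφ i⟩ := Subtype.ext (by simp)
  rw [e] at h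
  exact h

theorem toLp_hypLap {φ : Coord n → ℝ} (hφ : IsTest Ω φ) : hφ.hypLap.toLp =
    mulOp _ (memLp_top_height_sq Ω) (∑ j, ((hφ.pd j).pd j).toLp) +
      (2 - (n : ℝ)) • mulOp _ (memLp_top_height Ω) (hφ.pd (lastIdx n)).toLp := by
  have hs := IsTest.sum Finset.univ fun j (_ : j ∈ Finset.univ) => (hφ.pd j).pd j
  rw [mulOp_toLp _ (hφ.pd _) (IsTest.smooth_mul contDiff_height (hφ.pd _)),
    ← toLp_sum Finset.univ _ fun j => (hφ.pd j).pd j,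
    mulOp_toLp _ hs (IsTest.smooth_mul (contDiff_height.pow 2) hs)]
  have h : hypLap φ = (fun x => height x ^ 2) * ∑ j, pd j (pd j φ) +
      (2 - (n : ℝ)) • (height * pd (lastIdx n) φ) := by
    funext x
    simp [hypLap, mul_assoc]
  simp only [h]
  rfl

theorem exists_mem_graph_of_memH20 {u : Lp ℝ 2 (vol Ω)} (hu : MemH20 Ω u) :
    ∃ X ∈ graph Ω, X.1 = u := by
  obtain ⟨φ, d₁, d₂, ht, h0, h1, h2⟩ := hu
  have k0 := (tendsto_toLp_iff ht _).2 h0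
  have k1 := fun a => (tendsto_toLp_iff (fun j => (ht j).pd a) _).2 (h1 a)
  have k2 := fun a b => (tendsto_toLp_iff (fun j => ((ht j).pd b).pd a) _).2 (h2 a b)
  have kh := ((mulOp _ (memLp_top_height Ω)).continuous.tendsto _).comp (k1 (lastIdx n))
  have ks := ((mulOp _ (memLp_top_height_sq Ω)).continuous.tendsto _).comp
    (tendsto_finsetSum Finset.univ fun j _ => k2 j j)
  have hb := (kh.const_smul (2 : ℝ)).add (k0.const_smul (1 - (n : ℝ)))
  have hl := ks.add (kh.const_smul (2 - (n : ℝ)))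
  have hlim := k0.prodMk_nhds ((hb.congr fun j => (toLp_bop (ht j)).symm).prodMk_nhds
    (hl.congr fun j => (toLp_hypLap (ht j)).symm))
  exact ⟨_, isClosed_graph.mem_of_tendsto hlim (Eventually.of_forall fun j =>
    testTriple_mem_graph (Ω := Ω) ⟨φ j, ht j⟩), rfl⟩

theorem inner_snd_snd_eq {X : Lp ℝ 2 (vol Ω) × Lp ℝ 2 (vol Ω) × Lp ℝ 2 (vol Ω)}
    (hX : X ∈ graph Ω) {φ : Coord n → ℝ} (hφ : IsTest Ω φ) :
    ⟪X.2.2, hφ.hypLap.toLp⟫ = ∫ x, X.1 x * hypLap (hypLap φ) x ∂(vol Ω) := by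
  rw [← inner_toLp X.1 hφ.hypLap.hypLap]
  exact graph_symm X hX _ (testTriple_mem_graph ⟨_, hφ.hypLap⟩)

/-- One Laplacian is moved onto `u` by symmetry of the graph; both sides being continuous, testing
against C_c^∞ is the same as testing against the whole graph. -/
theorem solvesBiharm_iff {X : Lp ℝ 2 (vol Ω) × Lp ℝ 2 (vol Ω) × Lp ℝ 2 (vol Ω)}
    (hX : X ∈ graph Ω) {μ : ℝ} :
    SolvesBiharm Ω μ X.1 ↔ ∀ Y ∈ graph Ω, ⟪X.2.2, Y.2.2⟫ = μ * ⟪X.1, Y.1⟫ := by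
  constructor
  · intro h
    refine graph_induction (isClosed_eq (by fun_prop) (by fun_prop)) fun φ => ?_
    have hφ : IsTest Ω φ := φ.2
    change ⟪X.2.2, hφ.hypLap.toLp⟫ = μ * ⟪X.1, hφ.toLp⟫
    rw [inner_snd_snd_eq hX hφ, inner_toLp]
    exact h _ hφ
  · intro h φ hφ
    rw [← inner_snd_snd_eq hX hφ, ← inner_toLp X.1 hφ]
    exact h _ (testTriple_mem_graph ⟨φ, hφ⟩)

theorem mem_clampedEigenspace_iff {u : Lp ℝ 2 (vol Ω)} {μ : ℝ} :
    u ∈ clampedEigenspace Ω μ ↔ ∃ X ∈ graph Ω, X.1 = u ∧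
      ∀ Y ∈ graph Ω, ⟪X.2.2, Y.2.2⟫ = μ * ⟪X.1, Y.1⟫ := by
  constructor
  · rintro ⟨h1, h2⟩
    obtain ⟨X, hX, rfl⟩ := exists_mem_graph_of_memH20 h1
    exact ⟨X, hX, rfl, (solvesBiharm_iff hX).1 h2⟩
  · rintro ⟨X, hX, rfl, h⟩
    exact ⟨memH20_of_mem_graph hX, (solvesBiharm_iff hX).2 h⟩

/-- Testing with `X` itself gives ‖Δu‖² = μ‖u‖², and Δu = 0 would force u = 0 by the a priori bound.
-/
theorem eigenvalue_pos {X : Lp ℝ 2 (vol Ω) × Lp ℝ 2 (vol Ω) × Lp ℝ 2 (vol Ω)}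
    (hX : X ∈ graph Ω) (h0 : X.1 ≠ 0) {μ : ℝ}
    (h : ∀ Y ∈ graph Ω, ⟪X.2.2, Y.2.2⟫ = μ * ⟪X.1, Y.1⟫) : 0 < μ := by
  obtain ⟨C, hC⟩ := exists_graph_norm_le Ω
  have h1 := h X hX
  rw [real_inner_self_eq_norm_sq, real_inner_self_eq_norm_sq] at h1
  have h2 : 0 < ‖X.1‖ := norm_pos_iff.2 h0
  have h3 : X.2.2 ≠ 0 := fun h3 => by
    have := hC X hX
    rw [h3, norm_zero, mul_zero] at this
    linarith
  have h4 : 0 < ‖X.2.2‖ := norm_pos_iff.2 h3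
  exact pos_of_mul_pos_left (h1 ▸ pow_pos h4 2) (pow_pos h2 2).le

theorem inner_eq_zero_of_eigenvalue_ne {u v : Lp ℝ 2 (vol Ω)} {μ ν : ℝ}
    (hu : u ∈ clampedEigenspace Ω μ) (hv : v ∈ clampedEigenspace Ω ν) (hμν : μ ≠ ν) :
    ⟪u, v⟫ = 0 := by
  obtain ⟨X, hX, rfl, hXe⟩ := mem_clampedEigenspace_iff.1 hu
  obtain ⟨Y, hY, rfl, hYe⟩ := mem_clampedEigenspace_iff.1 hv
  have h1 := hXe Y hY
  have h2 := hYe X hX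
  rw [real_inner_comm, real_inner_comm X.1] at h2
  rw [real_inner_comm Y.2.2] at h1
  rw [real_inner_comm] at h1
  have h3 : (μ - ν) * ⟪X.1, Y.1⟫ = 0 := by
    rw [sub_mul]
    linarith
  exact (mul_eq_zero.1 h3).resolve_left (sub_ne_zero.2 hμν)

/-- Orthonormal eigenfunctions for the eigenvalues `lam 1, …, lam k`, which span the eigenspaces
of the eigenvalues below `lam (k + 1)`. -/
theorem IsClampedSpectrum.exists_orthonormal {lam : ℕ → ℝ} (hlam : IsClampedSpectrum Ω lam) {k : ℕ}
    (hgap : lam k < lam (k + 1)) :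
    ∃ u : Finset.Icc 1 k → Lp ℝ 2 (vol Ω), Orthonormal ℝ u ∧
      (∀ i : Finset.Icc 1 k, u i ∈ clampedEigenspace Ω (lam i)) ∧
      ∀ m < lam (k + 1), ∀ v ∈ clampedEigenspace Ω m, (∀ i, ⟪u i, v⟫ = 0) → v = 0 := by
  classical
  -- Monotonicity confines the indices carrying an eigenvalue below `lam (k + 1)` to 1, …, k.
  -- Through `mult` this makes its eigenspace finite-dimensional, with an orthonormal basis labelled
  -- by exactly these indices.
  have hidx : ∀ m < lam (k + 1), ∀ i : ℕ, 1 ≤ i ∧ lam i = m → i ∈ Finset.Icc 1 k := by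
    rintro m hm i ⟨hi, rfl⟩
    rw [Finset.mem_Icc]
    refine ⟨hi, ?_⟩
    by_contra hik
    exact absurd (hlam.mono (k + 1) i (by omega) (by omega)) (not_le.2 hm)
  have hbasis : ∀ m < lam (k + 1),
      ∃ b : {i : ℕ // 1 ≤ i ∧ lam i = m} → clampedEigenspace Ω m, Orthonormal ℝ b ∧
        ∀ v : clampedEigenspace Ω m, (∀ i, ⟪b i, v⟫ = 0) → v = 0 := by
    intro m hm
    have hfin : Finite {i : ℕ // 1 ≤ i ∧ lam i = m} :=
      (Finset.finite_toSet (Finset.Icc 1 k)).subset (hidx m hm)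
    have hcard := hlam.mult m
    have : FiniteDimensional ℝ (clampedEigenspace Ω m) := by
      rw [FiniteDimensional, ← Module.rank_lt_aleph0_iff, ← hcard]
      exact Cardinal.mk_lt_aleph0_iff.2 hfin
    have := Fintype.ofFinite {i : ℕ // 1 ≤ i ∧ lam i = m}
    have hfr : Module.finrank ℝ (clampedEigenspace Ω m) =
        Fintype.card {i : ℕ // 1 ≤ i ∧ lam i = m} := by
      rw [Module.finrank, ← hcard, Cardinal.mk_fintype, Cardinal.toNat_natCast]
    let b := (stdOrthonormalBasis ℝ (clampedEigenspace Ω m)).reindex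
      ((finCongr hfr).trans (Fintype.equivFin _).symm)
    refine ⟨b, b.orthonormal, fun v hv => ?_⟩
    have := b.sum_repr' v
    simp only [hv, zero_smul, Finset.sum_const_zero] at this
    exact this.symm
  choose! b hb using hbasis
  have hlt : ∀ i : Finset.Icc 1 k, lam i < lam (k + 1) := fun i =>
    (hlam.mono i k (Finset.mem_Icc.1 i.2).1 (Finset.mem_Icc.1 i.2).2).trans_lt hgap
  refine ⟨fun i => b (lam i) ⟨i, (Finset.mem_Icc.1 i.2).1, rfl⟩, ⟨fun i => ?_, fun i j hij => ?_⟩,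
    fun i => Subtype.property _, fun m hm v hv h => ?_⟩
  · exact (hb _ (hlt i)).1.1 _
  · by_cases hl : lam i = lam j
    · have h1 := (hb _ (hlt j)).1.2 (i := ⟨i, (Finset.mem_Icc.1 i.2).1, hl⟩)
        (j := ⟨j, (Finset.mem_Icc.1 j.2).1, rfl⟩) (by
          intro h
          exact hij (Subtype.ext (Subtype.mk.inj h)))
      -- For equal eigenvalues the vectors come from one basis, but the equality must be transported
      -- through the type indexed by `lam i` before orthogonality applies.
      have h2 : ∀ m (hm : lam i = m), (b (lam i) ⟨i, (Finset.mem_Icc.1 i.2).1, rfl⟩ :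
          Lp ℝ 2 (vol Ω)) = b m ⟨i, (Finset.mem_Icc.1 i.2).1, hm⟩ := by
        rintro m rfl
        rfl
      change ⟪(b (lam i) _ : Lp ℝ 2 (vol Ω)), (b (lam j) _ : Lp ℝ 2 (vol Ω))⟫ = 0
      rw [h2 _ hl]
      exact h1
    · exact inner_eq_zero_of_eigenvalue_ne (Subtype.property _) (Subtype.property _) hl
  · have h1 := (hb m hm).2 ⟨v, hv⟩ fun i => by
      obtain ⟨i, hi, rfl⟩ := i
      exact h ⟨i, hidx _ hm i ⟨hi, rfl⟩⟩
    exact congrArg Subtype.val h1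

end

end HypClamped

/-! ### The inequality for the clamped plate. -/

theorem theorem4p1 (n : ℕ) [NeZero n] (Ω : HypClamped.BoundedDomain n) (lam : ℕ → ℝ)
    (hlam : HypClamped.IsClampedSpectrum Ω lam) (k : ℕ) (hk : 1 ≤ k)
    (hgap : lam k < lam (k + 1)) (f g : ℝ → ℝ)
    (hfg : HypClamped.InClass (lam (k + 1)) f g) :
    ∑ i ∈ Finset.Icc 1 k, f (lam i) ≤
      √(∑ i ∈ Finset.Icc 1 k, g (lam i) * (6 * √(lam i) - ((n : ℝ) - 1) ^ 2)) *
      √(∑ i ∈ Finset.Icc 1 k, f (lam i) ^ 2 / (g (lam i) * (lam (k + 1) - lam i)) *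
          (4 * √(lam i) - ((n : ℝ) - 1) ^ 2)) := by
  obtain ⟨u, hon, hu, hspan⟩ := hlam.exists_orthonormal hgap
  choose X hX hXu hXe using fun i => HypClamped.mem_clampedEigenspace_iff.1 (hu i)
  have hon' : Orthonormal ℝ fun i => (X i).1 := by simpa only [hXu] using hon
  have hl : ∀ i : Finset.Icc 1 k, lam i ∈ Set.Ioo 0 (lam (k + 1)) := fun i =>
    ⟨HypClamped.eigenvalue_pos (hX i) (hon'.ne_zero i) (hXe i),
      (hlam.mono i k (Finset.mem_Icc.1 i.2).1 (Finset.mem_Icc.1 i.2).2).trans_lt hgap⟩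
  have key := HypClamped.sum_le_of_commutator (l := fun i : Finset.Icc 1 k => lam i)
    (HypClamped.graph Ω)
    (HypClamped.logOp Ω : _ →ₗ[ℝ] _) (HypClamped.mulOp_symm _) HypClamped.graph_skew
    HypClamped.graph_logOp HypClamped.graph_hardy hX hon' hl hXe (fun Y hY hYX => by
      -- A violation of the Rayleigh bound yields a unit eigenfunction with eigenvalue below `lam (k
      -- + 1)` orthogonal to all `u i`; by `hspan` it would be zero.
      by_contra! hlt
      obtain ⟨m, hm, Z, hZ, hZX, hZ1, hZe⟩ := HypClamped.exists_eigenvector_of_rayleigh_lt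
        (l := fun i : Finset.Icc 1 k => lam i) (HypClamped.graph Ω) HypClamped.isClosed_graph
        (fun W hW => le_trans (le_add_of_nonneg_right (by positivity))
          (HypClamped.graph_hardy W hW)) (HypClamped.totallyBounded_graph Ω) hX hon' hXe hY hYX hlt
      have h0 := hspan m hm Z.1 (HypClamped.mem_clampedEigenspace_iff.2 ⟨Z, hZ, rfl, hZe⟩)
        fun i => by rw [← hXu]; exact hZX i
      rw [h0, norm_zero] at hZ1
      exact zero_ne_one hZ1) hfg
  have hsum : ∀ F : ℕ → ℝ, ∑ i : Finset.Icc 1 k, F i = ∑ i ∈ Finset.Icc 1 k, F i :=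
    fun F => Finset.sum_coe_sort (Finset.Icc 1 k) F
  rw [hsum fun i => f (lam i), hsum fun i => g (lam i) * (6 * √(lam i) - ((n : ℝ) - 1) ^ 2),
    hsum fun i => f (lam i) ^ 2 / (g (lam i) * (lam (k + 1) - lam i)) *
      (4 * √(lam i) - ((n : ℝ) - 1) ^ 2)] at key
  exact key
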